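/- **Conventions.** $H^{N-1}$ is the $(N-1)$-dimensional Hausdorff measure on $\mathbb R^N$ (normalised as usual). Let $\Omega\subset\mathbb R^N$ be open. A *Lipschitz chart* of $\Omega$ consists of orthonormal coordinates $x=(x',t)\in\mathbb R^{N-1}\times\mathbb R$, a Lipschitz function $\varphi:\mathbb R^{N-1}\to\mathbb R$ and an open set $U$ such that $\Omega\cap U=\{x\in U:\ t>\varphi(x')\}$. $\Omega$ is *Lipschitz at* $x$ if some chart has $x\in U$; it is a *Lipschitz open set* if it is Lipschitz at every $x\in\partial\Omega$. If $x\in\partial\Omega\cap U$ and $\varphi$ is differentiable at $x'$, the *explicit chart (Nečas) inner normal* at $x$ is $\nu_2(x)=\dfrac{(-\nabla\varphi(x'),1)}{\sqrt{1+|\nabla\varphi(x')|^2}}$, written back in the original coordinates. A finite $\mathbb R^N$-valued Borel measure $D$ is the distributional gradient $D\chi_\Omega$ if $\int_\Omega \operatorname{div}u\,dx=-\int u\cdot dD$ for all $u\in C^1_c(\mathbb R^N,\mathbb R^N)$; $|D|$ is its total variation. The *reduced boundary* is the set of $x\in\operatorname{supp}|D|$ at which $\nu_1(x)=\lim_{r\downarrow0}D(B_r(x))/|D|(B_r(x))$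 exists and has norm $1$; $\nu_1$ is the *measure-theoretic (De Giorgi, Fusco) inner normal*. **(A)** Let $N\ge1$ and let $\Omega\subset\mathbb R^N$ be a Lipschitz open set with $H^{N-1}(\partial\Omega)<\infty$. Then $D\chi_\Omega$ exists and is unique, and 1. $|D\chi_\Omega|=H^{N-1}\lfloor\partial\Omega$; the reduced boundary is contained in $\partial\Omega$ and $H^{N-1}$-almost all of $\partial\Omega$ lies in it. 2. At $H^{N-1}$-a.e. $x\in\partial\Omega$ there is exactly one vector $\nu_2(x)$ which is the chart normal at $x$ in some chart whose function is differentiable at the corresponding point; and $\nu_1=\nu_2$ $H^{N-1}$-a.e. on $\partial\Omega$. Moreover, for every chart, $H^{N-1}$-a.e. on $\partial\Omega\cap U$ the function $\varphi$ is differentiable at $x'$ and $\nu_1(x)$ equals the normal given by that chart. 3. For $H^{N-1}$-a.e. $x\in\partial\Omega$ the blow-up of $\Omega$ at $x$ is the half-space of inner normal $\nu_1(x)$: $r^{-N}\,\bigl|(\Omega\,\triangle\,\{y:(y-x)\cdot\nu_1(x)>0\})\cap B_r(x)\bigr|\to0$ as $r\downarrow0$. 4. $\nu_1,\nu_2\in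 L^\infty(\partial\Omega,H^{N-1})$ and, for all $u\in C^1_c(\mathbb R^N,\mathbb R^N)$, $$\int_\Omega\operatorname{div}u\,dx=-\int_{\partial\Omega}u\cdot\nu_1\,dH^{N-1}=-\int_{\partial\Omega}u\cdot\nu_2\,dH^{N-1}.$$ **(B)** Let $N\ge2$ (in particular $N=2$), let $\Omega\subset\mathbb R^N$ be open with $H^{N-1}(\partial\Omega)<\infty$, and let $S$ be a finite set such that $\Omega$ is Lipschitz at every point of $\partial\Omega\setminus S$. Then at $H^{N-1}$-a.e. $x\in\partial\Omega$ the chart normal $\nu_2(x)$ exists and is unique in the sense of (A)2, $\nu_2\in L^\infty(\partial\Omega,H^{N-1})$, and for all $u\in C^1_c(\mathbb R^N,\mathbb R^N)$ $$\int_\Omega\operatorname{div}u\,dx=-\int_{\partial\Omega}u\cdot\nu_2\,dH^{N-1}.$$ -/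

import Mathlib

open MeasureTheory Set Filter Topology
open scoped RealInnerProductSpace symmDiff

/-- `ℝⁿ` with its Euclidean norm. -/
abbrev Euc (n : ℕ) : Type := EuclideanSpace ℝ (Fin n)

/-- Surface measure `H^d` on the topological boundary of `Ω ⊆ ℝ^{d+1}`; `μHE[d]` is the
`d`-dimensional Hausdorff measure with the usual normalisation (it is Lebesgue measure on `ℝ^d`). -/
noncomputable def boundaryMeasure {d : ℕ} (Ω : Set (Euc (d + 1))) : Measure (Euc (d + 1)) :=
  (μHE[d] : Measure (Euc (d + 1))).restrict (frontier Ω)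

/-- The divergence `∑ᵢ ∂ᵢ uᵢ`. -/
noncomputable def divergence {n : ℕ} (u : Euc n → Euc n) (x : Euc n) : ℝ :=
  ∑ i : Fin n, (fderiv ℝ u x (EuclideanSpace.single i 1)) i

/-! ### The measure-theoretic normal (De Giorgi) -/

/-- `D` is the distributional gradient `Dχ_Ω` of the indicator function of `Ω`:
a finite `ℝⁿ`-valued Borel measure with `∫_Ω div u = - ∫ u · dD` for all `u ∈ C¹_c(ℝⁿ, ℝⁿ)`. -/
def IsIndicatorGradient {n : ℕ} (Ω : Set (Euc n)) (D : VectorMeasure (Euc n) (Euc n)) : Prop :=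
  ∀ u : Euc n → Euc n, ContDiff ℝ 1 u → HasCompactSupport u →
    ∫ x in Ω, divergence u x = - ∫ᵛ x, u x ∂[innerSL ℝ; D]

/-- The ratio `D(B_r(x)) / |D|(B_r(x))`, where `|D|` is the total variation measure of `D`. -/
noncomputable def ballRatio {n : ℕ} (D : VectorMeasure (Euc n) (Euc n)) (x : Euc n) (r : ℝ) :
    Euc n :=
  (D.variation.real (Metric.ball x r))⁻¹ • D (Metric.ball x r)

/-- The reduced boundary of a set whose indicator has gradient `D`: the points `x` of the support
of `|D|` at which `D(B_r(x)) / |D|(B_r(x))` converges, as `r ↓ 0`, to a unit vector. -/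
def reducedBoundary {n : ℕ} (D : VectorMeasure (Euc n) (Euc n)) : Set (Euc n) :=
  {x | x ∈ D.variation.support ∧
    ∃ v : Euc n, ‖v‖ = 1 ∧ Tendsto (ballRatio D x) (𝓝[>] 0) (𝓝 v)}

/-- The measure-theoretic inner normal `ν₁(x) = lim_{r ↓ 0} D(B_r(x)) / |D|(B_r(x))`
(meaningful at the points of the reduced boundary). -/
noncomputable def deGiorgiNormal {n : ℕ} (D : VectorMeasure (Euc n) (Euc n)) (x : Euc n) : Euc n :=
  limUnder (𝓝[>] (0 : ℝ)) (ballRatio D x)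

/-! ### Lipschitz open sets and the explicit chart normal (Nečas) -/

/-- Data of a Lipschitz graph chart in `ℝ^{d+1}`: orthonormal coordinates
`R x = (x', t) ∈ ℝ^d × ℝ`, a Lipschitz function `φ` of `x'`, and an open set `U`. -/
structure LipschitzChart (d : ℕ) where
  R : Euc (d + 1) ≃ₗᵢ[ℝ] WithLp 2 (Euc d × ℝ)
  φ : Euc d → ℝ
  lipschitz : ∃ K : NNReal, LipschitzWith K φ
  U : Set (Euc (d + 1))
  isOpen_U : IsOpen U

namespace LipschitzChart

/-- The chart describes `Ω`: inside `U`, the set `Ω` is the strict epigraph of `φ`. -/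
def IsChartOf {d : ℕ} (c : LipschitzChart d) (Ω : Set (Euc (d + 1))) : Prop :=
  ∀ x ∈ c.U, x ∈ Ω ↔ c.φ (c.R x).fst < (c.R x).snd

/-- The explicit inner unit normal `(-∇φ(x'), 1) / √(1 + |∇φ(x')|²)`, written back in the
original coordinates (meaningful where `φ` is differentiable at `x'`). -/
noncomputable def normal {d : ℕ} (c : LipschitzChart d) (x : Euc (d + 1)) : Euc (d + 1) :=
  (Real.sqrt (1 + ‖gradient c.φ (c.R x).fst‖ ^ 2))⁻¹ •
    c.R.symm (WithLp.toLp 2 (-gradient c.φ (c.R x).fst, 1))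

end LipschitzChart

/-- Near `x`, the set `Ω` is, in suitable orthonormal coordinates, the strict epigraph of a
Lipschitz function. -/
def IsLipschitzAt {d : ℕ} (Ω : Set (Euc (d + 1))) (x : Euc (d + 1)) : Prop :=
  ∃ c : LipschitzChart d, c.IsChartOf Ω ∧ x ∈ c.U

/-- `Ω` is a Lipschitz open set. -/
def IsLipschitzOpen {d : ℕ} (Ω : Set (Euc (d + 1))) : Prop :=
  IsOpen Ω ∧ ∀ x ∈ frontier Ω, IsLipschitzAt Ω x

/-- `v` is the explicit inner normal of `Ω` at the boundary point `x`, computed in some chart whose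
function is differentiable at the point below `x`. -/
def IsNecasNormal {d : ℕ} (Ω : Set (Euc (d + 1))) (x v : Euc (d + 1)) : Prop :=
  x ∈ frontier Ω ∧ ∃ c : LipschitzChart d, c.IsChartOf Ω ∧ x ∈ c.U ∧
    DifferentiableAt ℝ c.φ (c.R x).fst ∧ v = c.normal x

open Classical in
/-- The explicit chart inner normal `ν₂` of `Ω`, with value `0` at the points where no chart
gives one. -/
noncomputable def necasNormal {d : ℕ} (Ω : Set (Euc (d + 1))) (x : Euc (d + 1)) : Euc (d + 1) :=
  if h : ∃ v, IsNecasNormal Ω x v then h.choose else 0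

/-- The integration by parts (Stokes) formula on `Ω` with inner normal field `ν`: `ν` is essentially
bounded on `∂Ω` (in particular measurable) and
`∫_Ω div u dx = - ∫_{∂Ω} u · ν dH^d` for all `u ∈ C¹_c(ℝ^{d+1}, ℝ^{d+1})`. -/
def StokesFormula {d : ℕ} (Ω : Set (Euc (d + 1))) (ν : Euc (d + 1) → Euc (d + 1)) : Prop :=
  MemLp ν ⊤ (boundaryMeasure Ω) ∧
    ∀ u : Euc (d + 1) → Euc (d + 1), ContDiff ℝ 1 u → HasCompactSupport u →
      ∫ x in Ω, divergence u x = - ∫ x, ⟪u x, ν x⟫ ∂(boundaryMeasure Ω)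

/-! ### Area formula for Lipschitz graphs -/

open scoped ENNReal NNReal in
/-- If `f` expands distances at most `K` times as much as `g` does, then the Hausdorff measure of
the image under `f` is controlled by that of the image under `g`. -/
theorem euclideanHausdorffMeasure_image_le_of_edist_le {α X Y : Type*} [EMetricSpace X]
    [MeasurableSpace X] [BorelSpace X] [EMetricSpace Y] [MeasurableSpace Y] [BorelSpace Y]
    (d : ℕ) {f : α → X} {g : α → Y} {K : ℝ≥0} {s : Set α}
    (h : ∀ x ∈ s, ∀ y ∈ s, edist (f x) (f y) ≤ K * edist (g x) (g y)) :
    μHE[d] (f '' s) ≤ (K : ℝ≥0∞) ^ d * μHE[d] (g '' s) := by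
  rcases s.eq_empty_or_nonempty with rfl | ⟨x₀, hx₀⟩
  · simp
  have : Nonempty α := ⟨x₀⟩
  have key : ∀ y ∈ g '' s, Function.invFunOn g s y ∈ s ∧ g (Function.invFunOn g s y) = y :=
    fun y hy => ⟨Function.invFunOn_mem hy, Function.invFunOn_eq hy⟩
  have hL : LipschitzOnWith K (f ∘ Function.invFunOn g s) (g '' s) := by
    intro y hy z hz
    have := h _ (key y hy).1 _ (key z hz).1
    rwa [(key y hy).2, (key z hz).2] at this
  have himg : f '' s = (f ∘ Function.invFunOn g s) '' (g '' s) := by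
    ext z
    constructor
    · rintro ⟨x, hx, rfl⟩
      refine ⟨g x, mem_image_of_mem g hx, ?_⟩
      have k := key (g x) (mem_image_of_mem g hx)
      have := h _ k.1 _ hx
      rw [k.2, edist_self, mul_zero] at this
      exact edist_le_zero.1 this
    · rintro ⟨y, hy, rfl⟩
      exact mem_image_of_mem f (key y hy).1
  have := hL.hausdorffMeasure_image_le (d := (d : ℝ)) (by positivity)
  rw [← himg, ENNReal.rpow_natCast] at this
  rw [Measure.euclideanHausdorffMeasure_def, Measure.euclideanHausdorffMeasure_def]
  simp only [Measure.smul_apply, Measure.nnreal_smul_coe_apply]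
  calc _ ≤ _ * ((K : ℝ≥0∞) ^ d * μH[d] (g '' s)) := by gcongr
    _ = _ := by ring

/-- The Jacobian `√(1 + |L|²)` of the graph of a function with derivative `L`. -/
noncomputable def graphJacobian {d : ℕ} (L : Euc d →L[ℝ] ℝ) : ℝ := Real.sqrt (1 + ‖L‖ ^ 2)

/-- The linear graph map `v ↦ (v, L v)`. -/
noncomputable def linearGraph {d : ℕ} (L : Euc d →L[ℝ] ℝ) : Euc d →ₗ[ℝ] WithLp 2 (Euc d × ℝ) where
  toFun v := WithLp.toLp 2 (v, L v)
  map_add' v w := by simp [← WithLp.toLp_add]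
  map_smul' c v := by simp [← WithLp.toLp_smul]

theorem linearGraph_apply {d : ℕ} (L : Euc d →L[ℝ] ℝ) (v : Euc d) :
    linearGraph L v = WithLp.toLp 2 (v, L v) := rfl

theorem normDet_linearGraph {d : ℕ} (L : Euc d →L[ℝ] ℝ) :
    (linearGraph L).normDet = graphJacobian L := by
  have hsq : (linearGraph L).normDet ^ 2 = 1 + ‖L‖ ^ 2 := by
    have h := (linearGraph L).normDet_sq_eq_det_gram (EuclideanSpace.basisFun (Fin d) ℝ)
    have hg : (Matrix.gram ℝ fun x => linearGraph L (EuclideanSpace.basisFun (Fin d) ℝ x)) =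
        1 + Matrix.replicateCol Unit (fun i => L (EuclideanSpace.basisFun (Fin d) ℝ i)) *
          Matrix.replicateRow Unit (fun i => L (EuclideanSpace.basisFun (Fin d) ℝ i)) := by
      ext i j
      have h1 := (orthonormal_iff_ite.1 (EuclideanSpace.basisFun (Fin d) ℝ).orthonormal) i j
      simp [Matrix.gram, linearGraph_apply, WithLp.prod_inner_apply, Matrix.mul_apply, Matrix.one_apply,
        -EuclideanSpace.basisFun_apply,
        -EuclideanSpace.inner_basisFun_real, -EuclideanSpace.basisFun_inner, h1, mul_comm]
    rw [hg, Matrix.det_one_add_replicateCol_mul_replicateRow] at h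
    rw [RCLike.ofReal_real_eq_id, id] at h
    rw [h]
    congr 1
    obtain ⟨w, rfl⟩ := (InnerProductSpace.toDual ℝ (Euc d)).surjective L
    rw [LinearIsometryEquiv.norm_map, ← OrthonormalBasis.sum_sq_norm_inner_left (EuclideanSpace.basisFun (Fin d) ℝ) w]
    simp only [dotProduct, InnerProductSpace.toDual_apply_apply, Real.norm_eq_abs, sq_abs]
    simp only [pow_two]
  rw [graphJacobian, ← hsq, Real.sqrt_sq (LinearMap.normDet_nonneg _)]

theorem one_le_graphJacobian {d : ℕ} (L : Euc d →L[ℝ] ℝ) : 1 ≤ graphJacobian L := by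
  rw [graphJacobian, Real.one_le_sqrt]
  nlinarith [norm_nonneg L]

theorem graphJacobian_le {d : ℕ} {L M : Euc d →L[ℝ] ℝ} {C : ℝ} (hC : 1 ≤ C)
    (h : ‖L - M‖ ≤ C - 1) : graphJacobian L ≤ C * graphJacobian M := by
  have h1 : ‖L‖ ≤ ‖M‖ + (C - 1) := by
    have := norm_le_norm_add_norm_sub' L M
    linarith
  have hM : ‖M‖ ≤ graphJacobian M := Real.le_sqrt_of_sq_le (by linarith)
  have hM2 : graphJacobian M ^ 2 = 1 + ‖M‖ ^ 2 := Real.sq_sqrt (by positivity)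
  have h1M := one_le_graphJacobian M
  rw [graphJacobian, Real.sqrt_le_iff]
  refine ⟨by positivity, ?_⟩
  have h2 : ‖L‖ ^ 2 ≤ (‖M‖ + (C - 1)) ^ 2 := by gcongr
  have h3 : (C - 1) * ‖M‖ ≤ (C - 1) * graphJacobian M := by gcongr
  have h4 : (C - 1) * 1 ≤ (C - 1) * graphJacobian M := by gcongr
  nlinarith

theorem continuous_graphJacobian {d : ℕ} :
    Continuous (graphJacobian : (Euc d →L[ℝ] ℝ) → ℝ) := by
  unfold graphJacobian; fun_prop

/-- The graph map `y ↦ (y, φ y)`. -/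
noncomputable def graphMap {d : ℕ} (φ : Euc d → ℝ) (y : Euc d) : WithLp 2 (Euc d × ℝ) :=
  WithLp.toLp 2 (y, φ y)

theorem graphMap_injective {d : ℕ} (φ : Euc d → ℝ) : Function.Injective (graphMap φ) := by
  intro x y h
  exact congrArg (fun z => z.fst) h

theorem continuous_graphMap {d : ℕ} {φ : Euc d → ℝ} (h : Continuous φ) :
    Continuous (graphMap φ) := by
  unfold graphMap; fun_prop

theorem norm_le_norm_linearGraph {d : ℕ} (L : Euc d →L[ℝ] ℝ) (v : Euc d) :
    ‖v‖ ≤ ‖linearGraph L v‖ := by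
  have h : ‖linearGraph L v‖ ^ 2 = ‖v‖ ^ 2 + ‖L v‖ ^ 2 := WithLp.prod_norm_sq_eq_of_L2 _
  exact le_of_sq_le_sq (by nlinarith [norm_nonneg (L v)]) (norm_nonneg _)

theorem norm_graphMap_sub_sub_linearGraph {d : ℕ} (φ : Euc d → ℝ) (L : Euc d →L[ℝ] ℝ)
    (x y : Euc d) :
    ‖graphMap φ x - graphMap φ y - linearGraph L (x - y)‖ = ‖φ x - φ y - L (x - y)‖ := by
  have : graphMap φ x - graphMap φ y - linearGraph L (x - y) =
      WithLp.toLp 2 ((0 : Euc d), φ x - φ y - L (x - y)) := by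
    simp only [graphMap, linearGraph_apply, ← WithLp.toLp_sub,
      Prod.mk_sub_mk, sub_self]
  rw [this, WithLp.prod_norm_eq_of_L2]
  simp [Real.sqrt_sq_eq_abs]

theorem lipschitzWith_graphMap {d : ℕ} {φ : Euc d → ℝ} {K : NNReal} (h : LipschitzWith K φ) :
    LipschitzWith (1 + K) (graphMap φ) := by
  refine LipschitzWith.of_dist_le_mul fun x y => ?_
  rw [dist_eq_norm, dist_eq_norm]
  have h1 := norm_graphMap_sub_sub_linearGraph φ 0 x y
  have h2 : ‖linearGraph (0 : Euc d →L[ℝ] ℝ) (x - y)‖ = ‖x - y‖ := by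
    simp [linearGraph_apply]
  have h3 := norm_le_norm_add_norm_sub' (graphMap φ x - graphMap φ y)
    (linearGraph (0 : Euc d →L[ℝ] ℝ) (x - y))
  have h4 := h.dist_le_mul x y
  rw [dist_eq_norm, dist_eq_norm] at h4
  simp only [zero_apply, sub_zero] at h1
  push_cast
  nlinarith

theorem le_of_le_on_pieces {α : Type*} [MeasurableSpace α] {μ₁ μ₂ : Measure α} {t : ℕ → Set α}
    (hd : Pairwise (Function.onFun Disjoint t)) (ht : ∀ n, MeasurableSet (t n)) {A : Set α}
    (hA : MeasurableSet A) (hAt : A ⊆ ⋃ n, t n) (h : ∀ n, μ₁ (A ∩ t n) ≤ μ₂ (A ∩ t n)) :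
    μ₁ A ≤ μ₂ A := by
  have hA' : A = ⋃ n, A ∩ t n := by rw [← inter_iUnion, inter_eq_left.2 hAt]
  calc μ₁ A = μ₁ (⋃ n, A ∩ t n) := by rw [← hA']
    _ ≤ ∑' n, μ₁ (A ∩ t n) := measure_iUnion_le _
    _ ≤ ∑' n, μ₂ (A ∩ t n) := ENNReal.tsum_le_tsum h
    _ = μ₂ (⋃ n, A ∩ t n) := (measure_iUnion
        (fun i j hij => (hd hij).mono inter_subset_right inter_subset_right)
        (fun n => hA.inter (ht n))).symm
    _ = μ₂ A := by rw [← hA']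

open scoped ENNReal NNReal in
theorem area_bounds_of_approximatesLinearOn {d : ℕ} {φ : Euc d → ℝ} {L : Euc d →L[ℝ] ℝ}
    {A : Set (Euc d)} {C ε : ℝ≥0} (hC : 1 + ε ≤ C) (hC' : 1 + ε * C ≤ C)
    (hA : MeasurableSet A) (hφ : ApproximatesLinearOn φ L A ε)
    (hL : ∀ x ∈ A, ‖fderiv ℝ φ x - L‖ ≤ ε) :
    μHE[d] (graphMap φ '' A) ≤
        (C : ℝ≥0∞) ^ (d + 1) * ∫⁻ x in A, ENNReal.ofReal (graphJacobian (fderiv ℝ φ x)) ∧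
      ∫⁻ x in A, ENNReal.ofReal (graphJacobian (fderiv ℝ φ x)) ≤
        (C : ℝ≥0∞) ^ (d + 1) * μHE[d] (graphMap φ '' A) := by
  have hCr : (1 : ℝ) + ε ≤ C := by exact_mod_cast hC
  have hCr' : (1 : ℝ) + ε * C ≤ C := by exact_mod_cast hC'
  have hC1 : (1 : ℝ) ≤ C := by linarith [ε.2]
  have hlin : μHE[d] (linearGraph L '' A) = ENNReal.ofReal (graphJacobian L) * volume A := by
    have := (linearGraph L).euclideanHausdorffMeasure_image_eq_normDet_mul_volume A
    rwa [normDet_linearGraph, finrank_euclideanSpace_fin] at this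
  have hnorm : ∀ x ∈ A, ∀ y ∈ A, ‖graphMap φ x - graphMap φ y - linearGraph L (x - y)‖ ≤
      ε * ‖linearGraph L (x - y)‖ := fun x hx y hy => by
    rw [norm_graphMap_sub_sub_linearGraph]
    refine (hφ x hx y hy).trans ?_
    gcongr
    exact norm_le_norm_linearGraph L _
  have h1 : μHE[d] (graphMap φ '' A) ≤ (C : ℝ≥0∞) ^ d * μHE[d] (linearGraph L '' A) := by
    refine euclideanHausdorffMeasure_image_le_of_edist_le d fun x hx y hy => ?_
    rw [edist_nndist, edist_nndist]
    have : dist (graphMap φ x) (graphMap φ y) ≤ C * dist (linearGraph L x) (linearGraph L y) := by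
      rw [dist_eq_norm, dist_eq_norm, ← map_sub]
      have := norm_le_norm_add_norm_sub' (graphMap φ x - graphMap φ y) (linearGraph L (x - y))
      nlinarith [hnorm x hx y hy, norm_nonneg (linearGraph L (x - y))]
    exact_mod_cast this
  have h2 : μHE[d] (linearGraph L '' A) ≤ (C : ℝ≥0∞) ^ d * μHE[d] (graphMap φ '' A) := by
    refine euclideanHausdorffMeasure_image_le_of_edist_le d fun x hx y hy => ?_
    rw [edist_nndist, edist_nndist]
    have : dist (linearGraph L x) (linearGraph L y) ≤ C * dist (graphMap φ x) (graphMap φ y) := by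
      rw [dist_eq_norm, dist_eq_norm, ← map_sub]
      have h3 := norm_le_norm_add_norm_sub (graphMap φ x - graphMap φ y) (linearGraph L (x - y))
      have h4 := hnorm x hx y hy
      have h5 : ‖linearGraph L (x - y)‖ * (1 + ε * C) ≤ ‖linearGraph L (x - y)‖ * C := by gcongr
      nlinarith
    exact_mod_cast this
  have h3 : ENNReal.ofReal (graphJacobian L) * volume A ≤
      C * ∫⁻ x in A, ENNReal.ofReal (graphJacobian (fderiv ℝ φ x)) := by
    rw [← setLIntegral_const, ← lintegral_const_mul' _ _ ENNReal.coe_ne_top]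
    refine setLIntegral_mono_ae' hA (Eventually.of_forall fun x hx => ?_)
    rw [← ENNReal.ofReal_coe_nnreal, ← ENNReal.ofReal_mul (NNReal.coe_nonneg C)]
    refine ENNReal.ofReal_le_ofReal (graphJacobian_le hC1 ?_)
    rw [norm_sub_rev]
    linarith [hL x hx]
  have h4 : ∫⁻ x in A, ENNReal.ofReal (graphJacobian (fderiv ℝ φ x)) ≤
      C * (ENNReal.ofReal (graphJacobian L) * volume A) := by
    rw [← setLIntegral_const, ← lintegral_const_mul' _ _ ENNReal.coe_ne_top]
    refine setLIntegral_mono_ae' hA (Eventually.of_forall fun x hx => ?_)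
    rw [← ENNReal.ofReal_coe_nnreal, ← ENNReal.ofReal_mul (NNReal.coe_nonneg C)]
    exact ENNReal.ofReal_le_ofReal (graphJacobian_le hC1 (by linarith [hL x hx]))
  rw [hlin] at h1 h2
  constructor
  · refine h1.trans ?_
    rw [pow_succ, mul_assoc]
    gcongr
  · refine h4.trans ?_
    rw [pow_succ', mul_assoc]
    gcongr

theorem measurableEmbedding_graphMap {d : ℕ} {φ : Euc d → ℝ} (h : Continuous φ) :
    MeasurableEmbedding (graphMap φ) :=
  (continuous_graphMap h).measurableEmbedding (graphMap_injective φ)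

open scoped ENNReal NNReal in
theorem area_bounds {d : ℕ} {φ : Euc d → ℝ} (hφ : Continuous φ) {C : ℝ≥0} (hC : 1 < C)
    {A : Set (Euc d)} (hA : MeasurableSet A) (hd : ∀ x ∈ A, DifferentiableAt ℝ φ x) :
    μHE[d] (graphMap φ '' A) ≤
        (C : ℝ≥0∞) ^ (d + 1) * ∫⁻ x in A, ENNReal.ofReal (graphJacobian (fderiv ℝ φ x)) ∧
      ∫⁻ x in A, ENNReal.ofReal (graphJacobian (fderiv ℝ φ x)) ≤
        (C : ℝ≥0∞) ^ (d + 1) * μHE[d] (graphMap φ '' A) := by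
  obtain ⟨ε, hε, h1, h2⟩ : ∃ ε : ℝ≥0, 0 < ε ∧ 1 + ε ≤ C ∧ 1 + ε * C ≤ C := by
    have hC0 : 0 < C := zero_lt_one.trans hC
    obtain ⟨δ, rfl⟩ := exists_add_of_le hC.le
    have hδ : 0 < δ := by simpa using hC
    refine ⟨δ / (1 + δ), by positivity, ?_, ?_⟩
    · gcongr
      exact div_le_self (zero_le) (by simp)
    · rw [div_mul_cancel₀ _ hC0.ne']
  set J : Measure (Euc d) :=
    volume.withDensity fun x => ENNReal.ofReal (graphJacobian (fderiv ℝ φ x)) with hJ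
  set m : Measure (Euc d) := (μHE[d] : Measure (WithLp 2 (Euc d × ℝ))).comap (graphMap φ) with hm
  have hme := measurableEmbedding_graphMap hφ
  have hmA : ∀ B, m B = μHE[d] (graphMap φ '' B) := fun B => hme.comap_apply _ _
  have hJA : ∀ B, MeasurableSet B →
      J B = ∫⁻ x in B, ENNReal.ofReal (graphJacobian (fderiv ℝ φ x)) :=
    fun B hB => withDensity_apply _ hB
  suffices H : m A ≤ ((C : ℝ≥0∞) ^ (d + 1) • J) A ∧ J A ≤ ((C : ℝ≥0∞) ^ (d + 1) • m) A by
    simpa only [hmA, hJA A hA, Measure.smul_apply, smul_eq_mul] using H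
  have hs : ∀ n, MeasurableSet (disjointed (fun n => {x : Euc d |
      fderiv ℝ φ x ∈ Metric.ball (TopologicalSpace.denseSeq (Euc d →L[ℝ] ℝ) n) (ε / 2)}) n) :=
    fun n => MeasurableSet.disjointed
      (fun n => (measurable_fderiv ℝ φ) Metric.isOpen_ball.measurableSet) n
  set s := disjointed (fun n => {x : Euc d |
      fderiv ℝ φ x ∈ Metric.ball (TopologicalSpace.denseSeq (Euc d →L[ℝ] ℝ) n) (ε / 2)}) with hsdef
  have hcov : ⋃ n, s n = univ := by
    rw [hsdef, iUnion_disjointed]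
    refine eq_univ_of_forall fun x => ?_
    obtain ⟨n, hn⟩ := (TopologicalSpace.denseRange_denseSeq (Euc d →L[ℝ] ℝ)).exists_dist_lt
      (fderiv ℝ φ x) (ε := ε / 2) (by positivity)
    exact mem_iUnion.2 ⟨n, hn⟩
  have hsd : Pairwise (Function.onFun Disjoint s) := disjoint_disjointed _
  have hAs : A ⊆ ⋃ n, s n := by rw [hcov]; exact subset_univ _
  have key : ∀ n, m (A ∩ s n) ≤ ((C : ℝ≥0∞) ^ (d + 1) • J) (A ∩ s n) ∧
      J (A ∩ s n) ≤ ((C : ℝ≥0∞) ^ (d + 1) • m) (A ∩ s n) := by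
    intro n
    have hAn : MeasurableSet (A ∩ s n) := hA.inter (hs n)
    obtain ⟨t, L, htd, htm, htc, hta, hty⟩ :=
      exists_partition_approximatesLinearOn_of_hasFDerivWithinAt φ (A ∩ s n) (fderiv ℝ φ)
        (fun x hx => (hd x hx.1).hasFDerivAt.hasFDerivWithinAt) (fun _ => ε) (fun _ => hε.ne')
    have hclose : ∀ k, ∀ x ∈ A ∩ s n ∩ t k, ‖fderiv ℝ φ x - L k‖ ≤ ε := by
      intro k x hx
      obtain ⟨y, hy, hLy⟩ := hty ⟨x, hx.1⟩ k
      rw [hLy, ← dist_eq_norm]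
      have hx1 := disjointed_subset _ _ hx.1.2
      have hy1 := disjointed_subset _ _ hy.2
      have hx2 : dist (fderiv ℝ φ x) _ < _ := hx1
      have hy2 : dist (fderiv ℝ φ y) _ < _ := hy1
      linarith [dist_triangle_right (fderiv ℝ φ x) (fderiv ℝ φ y)
        (TopologicalSpace.denseSeq (Euc d →L[ℝ] ℝ) n)]
    have hp := fun k => area_bounds_of_approximatesLinearOn h1 h2 (hAn.inter (htm k)) (hta k)
      (hclose k)
    constructor
    · refine le_of_le_on_pieces htd htm hAn htc fun k => ?_
      rw [hmA, Measure.smul_apply, hJA _ (hAn.inter (htm k))]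
      exact (hp k).1
    · refine le_of_le_on_pieces htd htm hAn htc fun k => ?_
      rw [Measure.smul_apply, hmA, hJA _ (hAn.inter (htm k))]
      exact (hp k).2
  exact ⟨le_of_le_on_pieces hsd hs hA hAs fun n => (key n).1,
    le_of_le_on_pieces hsd hs hA hAs fun n => (key n).2⟩

open scoped ENNReal NNReal in
/-- Area formula on the set of differentiability points. -/
theorem euclideanHausdorffMeasure_graph_image {d : ℕ} {φ : Euc d → ℝ} (hφ : Continuous φ)
    {A : Set (Euc d)} (hA : MeasurableSet A) (hd : ∀ x ∈ A, DifferentiableAt ℝ φ x) :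
    μHE[d] (graphMap φ '' A) = ∫⁻ x in A, ENNReal.ofReal (graphJacobian (fderiv ℝ φ x)) := by
  have key : ∀ a b : ℝ≥0∞, (∀ C : ℝ≥0, 1 < C → a ≤ (C : ℝ≥0∞) ^ (d + 1) * b) → a ≤ b := by
    intro a b h
    have hlim : Tendsto (fun C : ℝ≥0 => (C : ℝ≥0∞) ^ (d + 1) * b) (𝓝[>] 1) (𝓝 b) := by
      have h1 : Tendsto (fun C : ℝ≥0 => (C : ℝ≥0∞) ^ (d + 1)) (𝓝[>] 1) (𝓝 1) := by
        have : Continuous (fun C : ℝ≥0 => ((C ^ (d + 1) : ℝ≥0) : ℝ≥0∞)) := by fun_prop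
        have := (this.tendsto 1).mono_left (nhdsWithin_le_nhds (s := Ioi 1))
        simpa using this
      simpa using ENNReal.Tendsto.mul_const h1 (b := b) (Or.inl one_ne_zero)
    exact ge_of_tendsto hlim (eventually_nhdsWithin_of_forall fun C hC => h C hC)
  exact le_antisymm (key _ _ fun C hC => (area_bounds hφ hC hA hd).1)
    (key _ _ fun C hC => (area_bounds hφ hC hA hd).2)

theorem euclideanHausdorffMeasure_graph_image_eq_zero {d : ℕ} {φ : Euc d → ℝ} {K : NNReal}
    (hφ : LipschitzWith K φ) {A : Set (Euc d)} (hA : volume A = 0) :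
    μHE[d] (graphMap φ '' A) = 0 := by
  have h := euclideanHausdorffMeasure_image_le_of_edist_le d (f := graphMap φ) (g := id)
    (K := 1 + K) (s := A) fun x _ y _ => lipschitzWith_graphMap hφ x y
  rw [image_id, EuclideanSpace.euclideanHausdorffMeasure_eq_volume, hA, mul_zero] at h
  exact le_antisymm h (zero_le)

/-- **Area formula** for the graph of a Lipschitz function. -/
theorem map_graphMap_withDensity {d : ℕ} {φ : Euc d → ℝ} {K : NNReal} (hφ : LipschitzWith K φ) :
    (volume.withDensity fun x => ENNReal.ofReal (graphJacobian (fderiv ℝ φ x))).map (graphMap φ) =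
      (μHE[d] : Measure (WithLp 2 (Euc d × ℝ))).restrict (range (graphMap φ)) := by
  have hme := measurableEmbedding_graphMap hφ.continuous
  ext B hB
  have hB' : MeasurableSet (graphMap φ ⁻¹' B) := hme.measurable hB
  set D := {x | DifferentiableAt ℝ φ x}
  have hD : MeasurableSet D := measurableSet_of_differentiableAt ℝ φ
  have hnull : volume (graphMap φ ⁻¹' B \ D) = 0 := by
    refine measure_mono_null (fun x hx => hx.2) (ae_iff.1 (hφ.ae_differentiableAt (μ := volume)))
  rw [Measure.map_apply hme.measurable hB, Measure.restrict_apply hB,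
    ← image_preimage_eq_inter_range, withDensity_apply _ hB',
    ← measure_inter_add_sdiff (graphMap φ '' (graphMap φ ⁻¹' B)) (hme.measurableSet_image.2 hD),
    ← image_inter (graphMap_injective φ), ← image_sdiff (graphMap_injective φ),
    euclideanHausdorffMeasure_graph_image_eq_zero hφ hnull, add_zero,
    euclideanHausdorffMeasure_graph_image hφ.continuous (hB'.inter hD) fun x hx => hx.2]
  refine setLIntegral_congr ?_
  refine (ae_eq_set.2 ⟨?_, ?_⟩)
  · rwa [sdiff_self_inter]
  · rw [sdiff_eq_empty.2 inter_subset_left, measure_empty]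

/-! ### Integration by parts on the epigraph of a Lipschitz function -/

/-- The integral of a directional derivative of a compactly supported Lipschitz function
vanishes. -/
theorem integral_lineDeriv_eq_zero {E : Type*} [NormedAddCommGroup E] [NormedSpace ℝ E]
    [MeasurableSpace E] [BorelSpace E] [FiniteDimensional ℝ E] {μ : Measure E}
    [μ.IsAddHaarMeasure] {K : NNReal} {g : E → ℝ} (hg : LipschitzWith K g)
    (hgc : HasCompactSupport g) (v : E) : ∫ x, lineDeriv ℝ g x v ∂μ = 0 := by
  have h := LipschitzWith.integral_lineDeriv_mul_eq (μ := μ) (f := fun _ : E => (1 : ℝ))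
    (C := 0) (LipschitzWith.const _) hg hgc (-v)
  have h0 : ∀ x, lineDeriv ℝ (fun _ : E => (1 : ℝ)) x (-v) = 0 := fun x => by
    simp [lineDeriv]
  simpa [h0] using h.symm

theorem integral_vertical_deriv {E : Type*} [NormedAddCommGroup E] [NormedSpace ℝ E]
    {F : E × ℝ → ℝ} {φ : E → ℝ} (hF : ContDiff ℝ 1 F) (hFc : HasCompactSupport F) (y : E) :
    ∫ s in Ioi (0 : ℝ), fderiv ℝ F (y, φ y + s) (0, 1) = -F (y, φ y) := by
  set f : ℝ → ℝ := fun s => F (y, φ y + s) with hf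
  have hcd : ContDiff ℝ 1 f := hF.comp (by fun_prop)
  have hcs : HasCompactSupport f := by
    refine HasCompactSupport.intro
      (hFc.isCompact.image (f := fun z : E × ℝ => z.2 - φ y) (by fun_prop)) fun s hs => ?_
    by_contra h
    exact hs ⟨_, subset_tsupport _ h, by simp⟩
  have hd : ∀ s, deriv f s = fderiv ℝ F (y, φ y + s) (0, 1) := by
    intro s
    have h1 : HasDerivAt (fun s : ℝ => (y, φ y + s)) ((0 : E), (1 : ℝ)) s :=
      (hasDerivAt_const s y).prodMk ((hasDerivAt_id s).const_add (φ y))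
    exact (((hF.differentiable one_ne_zero) _).hasFDerivAt.comp_hasDerivAt s h1).deriv
  simp_rw [← hd]
  rw [hcs.integral_Ioi_deriv_eq hcd 0]
  simp [hf]

section Epigraph

variable {E : Type*} [NormedAddCommGroup E] [InnerProductSpace ℝ E] [MeasurableSpace E]
  [BorelSpace E] [FiniteDimensional ℝ E] {F : E × ℝ → ℝ} {φ : E → ℝ} {K : NNReal}

theorem measurePreserving_shear (hφ : Continuous φ) :
    MeasurePreserving (fun z : E × ℝ => (z.1, φ z.1 + z.2)) volume volume := by
  refine MeasurePreserving.skew_product (f := id) (g := fun x t => φ x + t)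
    (MeasurePreserving.id volume) (by fun_prop) (Eventually.of_forall fun x => ?_)
  exact (measurePreserving_add_left volume (φ x)).map_eq

theorem measurableEmbedding_shear (hφ : Continuous φ) :
    MeasurableEmbedding (fun z : E × ℝ => (z.1, φ z.1 + z.2)) := by
  refine Continuous.measurableEmbedding (by fun_prop) ?_
  rintro ⟨x, s⟩ ⟨y, t⟩ h
  simp only [Prod.mk.injEq] at h
  obtain ⟨rfl, h⟩ := h
  simpa using h

theorem integrable_sheared_deriv (hF : ContDiff ℝ 1 F) (hFc : HasCompactSupport F)
    (hφ : LipschitzWith K φ) (v : E) :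
    Integrable (fun z : E × ℝ => fderiv ℝ F (z.1, φ z.1 + z.2) (v, fderiv ℝ φ z.1 v)) := by
  have hcont : Continuous (fun z : E × ℝ => fderiv ℝ F (z.1, φ z.1 + z.2)) :=
    (hF.continuous_fderiv one_ne_zero).comp (by have := hφ.continuous; fun_prop)
  have hint : Integrable (fun z : E × ℝ => ‖fderiv ℝ F z‖) :=
    ((hF.continuous_fderiv one_ne_zero).integrable_of_hasCompactSupport (hFc.fderiv ℝ)).norm
  have hint2 : Integrable (fun z : E × ℝ => ‖fderiv ℝ F (z.1, φ z.1 + z.2)‖ * max ‖v‖ (K * ‖v‖)) :=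
    ((measurePreserving_shear hφ.continuous).integrable_comp_of_integrable hint).mul_const _
  refine hint2.mono' ?_ (Eventually.of_forall fun z => ?_)
  · have hm : Measurable fun z : E × ℝ => (v, fderiv ℝ φ z.1 v) :=
      measurable_const.prodMk (((measurable_fderiv_apply_const ℝ φ v)).comp measurable_fst)
    exact isBoundedBilinearMap_apply.continuous.comp_aestronglyMeasurable
      (hcont.aestronglyMeasurable.prodMk hm.aestronglyMeasurable)
  · refine (ContinuousLinearMap.le_opNorm _ _).trans ?_
    gcongr
    rw [Prod.norm_def]
    refine max_le_max le_rfl ((ContinuousLinearMap.le_opNorm _ _).trans ?_)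
    gcongr
    exact norm_fderiv_le_of_lipschitz ℝ hφ

theorem integral_sheared_deriv_eq_zero (hF : ContDiff ℝ 1 F) (hFc : HasCompactSupport F)
    (hφ : LipschitzWith K φ) (v : E) (s : ℝ) :
    ∫ y, fderiv ℝ F (y, φ y + s) (v, fderiv ℝ φ y v) = 0 := by
  set w : E → ℝ := fun y => F (y, φ y + s) with hw
  obtain ⟨C, hC⟩ := hF.lipschitzWith_of_hasCompactSupport hFc one_ne_zero
  have hwl : LipschitzWith (C * max 1 K) w := by
    refine hC.comp (LipschitzWith.prodMk LipschitzWith.id ?_)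
    refine LipschitzWith.of_dist_le_mul fun x y => ?_
    rw [dist_add_right]
    exact hφ.dist_le_mul x y
  have hwc : HasCompactSupport w := by
    refine HasCompactSupport.intro (hFc.isCompact.image continuous_fst) fun y hy => ?_
    by_contra h
    exact hy ⟨_, subset_tsupport _ h, rfl⟩
  rw [← integral_lineDeriv_eq_zero (μ := volume) hwl hwc v]
  refine integral_congr_ae ?_
  filter_upwards [hφ.ae_differentiableAt (μ := volume)] with y hy
  have h1 : HasFDerivAt (fun y => (y, φ y + s))
      ((ContinuousLinearMap.id ℝ E).prod (fderiv ℝ φ y)) y :=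
    (hasFDerivAt_id y).prodMk (hy.hasFDerivAt.add_const s)
  have h2 := ((hF.differentiable one_ne_zero) (y, φ y + s)).hasFDerivAt.comp y h1
  have h3 : lineDeriv ℝ w y v = _ := (h2.hasLineDerivAt v).lineDeriv
  rw [h3]
  rfl

/-- Integration by parts on the epigraph of a Lipschitz function, in the direction `(v, s)`. -/
theorem integral_fderiv_epigraph (hF : ContDiff ℝ 1 F) (hFc : HasCompactSupport F)
    (hφ : LipschitzWith K φ) (v : E) (c : ℝ) :
    ∫ z in {z : E × ℝ | φ z.1 < z.2}, fderiv ℝ F z (v, c) =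
      ∫ y, (fderiv ℝ φ y v - c) * F (y, φ y) := by
  have hshear := measurePreserving_shear hφ.continuous (E := E)
  have hint0 : ∀ v c, Integrable (fun z : E × ℝ => fderiv ℝ F z (v, c)) := fun v c =>
    ((hF.continuous_fderiv one_ne_zero).clm_apply continuous_const).integrable_of_hasCompactSupport
      (hFc.fderiv_apply ℝ (v, c))
  have hint1 : ∀ v c, Integrable (fun z : E × ℝ => fderiv ℝ F (z.1, φ z.1 + z.2) (v, c)) :=
    fun v c => hshear.integrable_comp_of_integrable (hint0 v c)
  have hint2 := integrable_sheared_deriv hF hFc hφ v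
  have hpre : (fun z : E × ℝ => (z.1, φ z.1 + z.2)) ⁻¹' {z : E × ℝ | φ z.1 < z.2} =
      univ ×ˢ Ioi (0 : ℝ) := by
    ext z; simp
  have hrest : (volume : Measure (E × ℝ)).restrict (univ ×ˢ Ioi (0 : ℝ)) =
      (volume : Measure E).prod ((volume : Measure ℝ).restrict (Ioi 0)) := by
    rw [Measure.volume_eq_prod, ← Measure.prod_restrict, Measure.restrict_univ]
  rw [← hshear.setIntegral_preimage_emb (measurableEmbedding_shear hφ.continuous), hpre, hrest]
  have hint1' : ∀ v c, Integrable (fun z : E × ℝ => fderiv ℝ F (z.1, φ z.1 + z.2) (v, c))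
      ((volume : Measure E).prod ((volume : Measure ℝ).restrict (Ioi 0))) := fun v c => by
    rw [← hrest]; exact (hint1 v c).restrict
  have hint2' : Integrable
      (fun z : E × ℝ => fderiv ℝ F (z.1, φ z.1 + z.2) (v, fderiv ℝ φ z.1 v))
      ((volume : Measure E).prod ((volume : Measure ℝ).restrict (Ioi 0))) := by
    rw [← hrest]; exact hint2.restrict
  have hzero : ∫ z, fderiv ℝ F (z.1, φ z.1 + z.2) (v, fderiv ℝ φ z.1 v)
      ∂((volume : Measure E).prod ((volume : Measure ℝ).restrict (Ioi 0))) = 0 := by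
    rw [integral_prod_symm _ hint2']
    simp [integral_sheared_deriv_eq_zero hF hFc hφ v]
  have hsub := integral_sub (hint1' v c) hint2'
  rw [hzero, sub_zero] at hsub
  rw [← hsub]
  refine (integral_prod _ ((hint1' v c).sub hint2')).trans ?_
  refine integral_congr_ae (Eventually.of_forall fun y => ?_)
  have : ∀ s, fderiv ℝ F (y, φ y + s) (v, c) - fderiv ℝ F (y, φ y + s) (v, fderiv ℝ φ y v) =
      (c - fderiv ℝ φ y v) * fderiv ℝ F (y, φ y + s) (0, 1) := fun s => by
    rw [← map_sub, ← smul_eq_mul, ← map_smul]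
    simp
  simp only [Pi.sub_apply, this]
  rw [integral_const_mul, integral_vertical_deriv hF hFc]
  ring

end Epigraph

theorem divergence_eq_sum {n : ℕ} {u : Euc n → Euc n} (hu : Differentiable ℝ u) (x : Euc n) :
    divergence u x = ∑ i, fderiv ℝ (fun x => u x i) x (EuclideanSpace.single i 1) := by
  refine Finset.sum_congr rfl fun i _ => ?_
  have h1 := (EuclideanSpace.proj i : Euc n →L[ℝ] ℝ).hasFDerivAt.comp x (hu x).hasFDerivAt
  have h2 : fderiv ℝ (fun x => u x i) x = _ := h1.fderiv
  rw [h2]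
  rfl

/-! ### Lipschitz charts -/

namespace LipschitzChart

variable {d : ℕ} (c : LipschitzChart d)

/-- Parametrisation of the graph described by a chart. -/
noncomputable def param (y : Euc d) : Euc (d + 1) := c.R.symm (graphMap c.φ y)

/-- The strict epigraph described by a chart. -/
def epigraph : Set (Euc (d + 1)) := {x | c.φ (c.R x).fst < (c.R x).snd}

theorem continuous_φ : Continuous c.φ := c.lipschitz.choose_spec.continuous

theorem R_param (y : Euc d) : c.R (c.param y) = graphMap c.φ y := c.R.apply_symm_apply _

theorem R_param_fst (y : Euc d) : (c.R (c.param y)).fst = y := by rw [R_param]; rfl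

theorem mem_range_param {x : Euc (d + 1)} :
    x ∈ range c.param ↔ c.φ (c.R x).fst = (c.R x).snd := by
  constructor
  · rintro ⟨y, rfl⟩
    rw [R_param]; rfl
  · intro h
    refine ⟨(c.R x).fst, ?_⟩
    rw [param, LinearIsometryEquiv.symm_apply_eq]
    exact WithLp.ofLp_injective 2 (Prod.ext rfl h)

theorem continuous_param : Continuous c.param :=
  c.R.symm.continuous.comp (continuous_graphMap c.continuous_φ)

theorem param_injective : Function.Injective c.param :=
  c.R.symm.injective.comp (graphMap_injective _)

theorem measurableEmbedding_param : MeasurableEmbedding c.param :=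
  c.continuous_param.measurableEmbedding c.param_injective

theorem continuous_height : Continuous fun x => (c.R x).snd - c.φ (c.R x).fst := by
  have := c.continuous_φ
  fun_prop

theorem measurableSet_epigraph : MeasurableSet c.epigraph := by
  have : c.epigraph = {x | 0 < (c.R x).snd - c.φ (c.R x).fst} := by
    ext x; simp [epigraph]
  rw [this]
  exact (isOpen_lt continuous_const c.continuous_height).measurableSet

theorem map_param_withDensity :
    (volume.withDensity fun y => ENNReal.ofReal (graphJacobian (fderiv ℝ c.φ y))).map c.param =
      (μHE[d] : Measure (Euc (d + 1))).restrict (range c.param) := by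
  obtain ⟨K, hK⟩ := c.lipschitz
  have hR : MeasurePreserving c.R.symm (μHE[d]) (μHE[d]) :=
    c.R.symm.toIsometryEquiv.measurePreserving_euclideanHausdorffMeasure d
  have h1 : c.param = c.R.symm ∘ graphMap c.φ := rfl
  rw [h1, ← Measure.map_map c.R.symm.continuous.measurable
    (continuous_graphMap c.continuous_φ).measurable, map_graphMap_withDensity hK, range_comp]
  exact (hR.restrict_image_emb c.R.symm.toHomeomorph.measurableEmbedding _).map_eq

theorem ae_differentiableAt_of_range :
    ∀ᵐ x ∂(μHE[d] : Measure (Euc (d + 1))).restrict (range c.param),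
      DifferentiableAt ℝ c.φ (c.R x).fst := by
  obtain ⟨K, hK⟩ := c.lipschitz
  rw [← map_param_withDensity, c.measurableEmbedding_param.ae_map_iff]
  simp only [R_param_fst]
  exact (withDensity_absolutelyContinuous _ _).ae_le (hK.ae_differentiableAt (μ := volume))

/-- The upward conormal `(-∇φ, 1)` in the original coordinates. -/
noncomputable def conormal (y : Euc d) : Euc (d + 1) :=
  c.R.symm (WithLp.toLp 2 (-gradient c.φ y, 1))

theorem graphJacobian_eq (y : Euc d) :
    graphJacobian (fderiv ℝ c.φ y) = Real.sqrt (1 + ‖gradient c.φ y‖ ^ 2) := by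
  rw [graphJacobian, ← toDual_gradient, LinearIsometryEquiv.norm_map]

theorem norm_conormal (y : Euc d) : ‖c.conormal y‖ = graphJacobian (fderiv ℝ c.φ y) := by
  rw [conormal, LinearIsometryEquiv.norm_map, WithLp.prod_norm_eq_of_L2, graphJacobian_eq]
  simp [add_comm]

theorem smul_normal (x : Euc (d + 1)) :
    graphJacobian (fderiv ℝ c.φ (c.R x).fst) • c.normal x = c.conormal (c.R x).fst := by
  have h := one_le_graphJacobian (fderiv ℝ c.φ (c.R x).fst)
  rw [normal, ← graphJacobian_eq, smul_smul, mul_inv_cancel₀ (by positivity), one_smul, conormal]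

theorem norm_normal (x : Euc (d + 1)) : ‖c.normal x‖ = 1 := by
  have h := one_le_graphJacobian (fderiv ℝ c.φ (c.R x).fst)
  have h1 := congrArg norm (c.smul_normal x)
  rw [norm_smul, norm_conormal, Real.norm_of_nonneg (by positivity)] at h1
  exact mul_left_cancel₀ (by positivity) (h1.trans (mul_one _).symm)

theorem inner_conormal (y : Euc d) (v : Euc (d + 1)) :
    ⟪c.conormal y, v⟫ = (c.R v).snd - fderiv ℝ c.φ y (c.R v).fst := by
  rw [conormal, ← LinearIsometryEquiv.inner_map_map c.R, LinearIsometryEquiv.apply_symm_apply,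
    WithLp.prod_inner_apply, ← inner_gradient_left]
  change ⟪-gradient c.φ y, (c.R v).fst⟫ + ⟪(1 : ℝ), (c.R v).snd⟫ = _
  rw [inner_neg_left, show ⟪(1 : ℝ), (c.R v).snd⟫ = (c.R v).snd by simp]
  ring

theorem measurable_gradient {E : Type*} [NormedAddCommGroup E] [InnerProductSpace ℝ E]
    [CompleteSpace E] [MeasurableSpace E] [BorelSpace E] (f : E → ℝ) :
    Measurable (gradient f) :=
  (InnerProductSpace.toDual ℝ E).symm.continuous.measurable.comp (measurable_fderiv ℝ f)

theorem measurable_conormal : Measurable c.conormal := by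
  have h := measurable_gradient c.φ
  unfold conormal
  refine c.R.symm.continuous.measurable.comp ?_
  exact (WithLp.measurable_toLp 2 _).comp (h.neg.prodMk measurable_const)

theorem measurable_normal : Measurable c.normal := by
  have hR : Measurable fun x => (c.R x).fst := by
    have : Continuous fun x => (c.R x).fst := by fun_prop
    exact this.measurable
  have h := (measurable_gradient c.φ).comp hR
  have h2 : Measurable fun x => c.conormal (c.R x).fst := c.measurable_conormal.comp hR
  exact ((((h.norm.pow_const 2).const_add 1).sqrt).inv).smul h2

theorem integral_fderiv_epigraph {f : Euc (d + 1) → ℝ} (hf : ContDiff ℝ 1 f)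
    (hfc : HasCompactSupport f) (v : Euc (d + 1)) :
    ∫ x in c.epigraph, fderiv ℝ f x v = -∫ y, ⟪c.conormal y, v⟫ * f (c.param y) := by
  obtain ⟨K, hK⟩ := c.lipschitz
  set T : (Euc d × ℝ) ≃L[ℝ] Euc (d + 1) :=
    (WithLp.prodContinuousLinearEquiv 2 ℝ (Euc d) ℝ).symm.trans
      c.R.symm.toContinuousLinearEquiv
  have hRT : ∀ z, c.R (T z) = WithLp.toLp 2 z := fun z => c.R.apply_symm_apply _
  have hmp : MeasurePreserving T volume volume :=
    c.R.symm.measurePreserving.comp (WithLp.volume_preserving_toLp _ _)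
  have hpre : T ⁻¹' c.epigraph = {z | c.φ z.1 < z.2} := by
    ext z
    simp only [epigraph, mem_preimage, mem_ofPred_eq, hRT]
    rfl
  have hF : ContDiff ℝ 1 (f ∘ T) := hf.comp T.contDiff
  have hFc : HasCompactSupport (f ∘ T) := hfc.comp_homeomorph T.toHomeomorph
  have hd : ∀ z, fderiv ℝ (f ∘ T) z ((c.R v).fst, (c.R v).snd) = fderiv ℝ f (T z) v := by
    intro z
    rw [ContinuousLinearEquiv.comp_right_fderiv]
    simp only [ContinuousLinearMap.comp_apply]
    congr 1
    exact c.R.symm_apply_apply v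
  rw [← hmp.setIntegral_preimage_emb T.toHomeomorph.measurableEmbedding, hpre]
  simp_rw [← hd]
  rw [_root_.integral_fderiv_epigraph hF hFc hK, ← integral_neg]
  refine integral_congr_ae (Eventually.of_forall fun y => ?_)
  simp only [inner_conormal]
  have : (f ∘ T) (y, c.φ y) = f (c.param y) := rfl
  rw [this]
  ring

theorem hasCompactSupport_comp_param {f : Euc (d + 1) → ℝ} (hfc : HasCompactSupport f) :
    HasCompactSupport (f ∘ c.param) := by
  refine HasCompactSupport.intro
    (hfc.isCompact.image (f := fun x => (c.R x).fst) (by fun_prop)) fun y hy => ?_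
  by_contra h
  exact hy ⟨_, subset_tsupport _ h, c.R_param_fst y⟩

theorem norm_inner_conormal_le {K : NNReal} (hK : LipschitzWith K c.φ) (y : Euc d)
    (v : Euc (d + 1)) : ‖⟪c.conormal y, v⟫‖ ≤ Real.sqrt (1 + K ^ 2) * ‖v‖ := by
  refine (norm_inner_le_norm _ _).trans ?_
  rw [norm_conormal, graphJacobian]
  gcongr
  exact norm_fderiv_le_of_lipschitz ℝ hK

theorem integrable_conormal_mul {f : Euc (d + 1) → ℝ} (hf : Continuous f)
    (hfc : HasCompactSupport f) (v : Euc (d + 1)) :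
    Integrable fun y => ⟪c.conormal y, v⟫ * f (c.param y) := by
  obtain ⟨K, hK⟩ := c.lipschitz
  have hint : Integrable (f ∘ c.param) :=
    (hf.comp c.continuous_param).integrable_of_hasCompactSupport
      (c.hasCompactSupport_comp_param hfc)
  exact hint.bdd_mul (c := Real.sqrt (1 + K ^ 2) * ‖v‖)
    (c.measurable_conormal.inner_const.aestronglyMeasurable)
    (Eventually.of_forall fun y => c.norm_inner_conormal_le hK y v)

/-- The divergence theorem on the epigraph described by a chart. -/
theorem integral_divergence_epigraph {u : Euc (d + 1) → Euc (d + 1)} (hu : ContDiff ℝ 1 u)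
    (huc : HasCompactSupport u) :
    ∫ x in c.epigraph, divergence u x =
      -∫ x, ⟪u x, c.normal x⟫ ∂(μHE[d] : Measure (Euc (d + 1))).restrict (range c.param) := by
  have hui : ∀ i, ContDiff ℝ 1 fun x => u x i := fun i => by fun_prop
  have huci : ∀ i, HasCompactSupport fun x => u x i := fun i =>
    huc.comp_left (g := fun z : Euc (d + 1) => z i) rfl
  simp_rw [divergence_eq_sum (hu.differentiable one_ne_zero)]
  rw [integral_finsetSum _ fun i _ => ?_]
  swap
  · exact ((((hui i).continuous_fderiv one_ne_zero).clm_apply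
      continuous_const).integrable_of_hasCompactSupport
      ((huci i).fderiv_apply ℝ _)).integrableOn
  simp_rw [fun i => c.integral_fderiv_epigraph (hui i) (huci i) (EuclideanSpace.single i 1)]
  rw [Finset.sum_neg_distrib, ← integral_finsetSum _
    fun i _ => c.integrable_conormal_mul (hui i).continuous (huci i) _]
  congr 1
  have hJm : Measurable fun y => ENNReal.ofReal (graphJacobian (fderiv ℝ c.φ y)) :=
    (continuous_graphJacobian.measurable.comp (measurable_fderiv ℝ c.φ)).ennreal_ofReal
  rw [← map_param_withDensity, c.measurableEmbedding_param.integral_map,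
    integral_withDensity_eq_integral_toReal_smul hJm (by simp)]
  refine integral_congr_ae (Eventually.of_forall fun y => ?_)
  have h1 := one_le_graphJacobian (fderiv ℝ c.φ y)
  have h2 := c.smul_normal (c.param y)
  rw [R_param_fst] at h2
  simp only [ENNReal.toReal_ofReal (zero_le_one.trans h1), smul_eq_mul]
  rw [← real_inner_smul_right, h2, real_inner_comm,
    ← (EuclideanSpace.basisFun (Fin (d + 1)) ℝ).sum_inner_mul_inner]
  refine Finset.sum_congr rfl fun i _ => ?_
  simp only [EuclideanSpace.basisFun_apply]
  congr 1
  simp [EuclideanSpace.inner_single_left]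

variable {c} {Ω : Set (Euc (d + 1))}

theorem mem_frontier_iff (hc : c.IsChartOf Ω) {x : Euc (d + 1)} (hx : x ∈ c.U) :
    x ∈ frontier Ω ↔ x ∈ range c.param := by
  rw [mem_range_param]
  have hU : c.U ∈ 𝓝 x := c.isOpen_U.mem_nhds hx
  have hcont := c.continuous_height.tendsto x
  constructor
  · intro h
    rcases lt_trichotomy (c.φ (c.R x).fst) (c.R x).snd with h1 | h1 | h1
    · exfalso
      refine h.2 (mem_interior_iff_mem_nhds.2 ?_)
      filter_upwards [hU, hcont.eventually_const_lt (sub_pos.2 h1)] with y hy hy2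
      exact (hc y hy).2 (sub_pos.1 hy2)
    · exact h1
    · exfalso
      have : ∃ᶠ y in 𝓝 x, y ∈ Ω := mem_closure_iff_frequently.1 h.1
      refine this ?_
      filter_upwards [hU, hcont.eventually_lt_const (sub_neg.2 h1)] with y hy hy2 hy3
      exact (sub_neg.1 hy2).not_gt ((hc y hy).1 hy3)
  · intro h
    refine ⟨?_, fun h2 => ?_⟩
    · set e : Euc (d + 1) := c.R.symm (WithLp.toLp 2 (0, 1))
      have hlim : Tendsto (fun s : ℝ => x + s • e) (𝓝[>] 0) (𝓝 x) := by
        have : Continuous fun s : ℝ => x + s • e := by fun_prop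
        have := (this.tendsto 0).mono_left (nhdsWithin_le_nhds (s := Ioi 0))
        simpa using this
      refine mem_closure_of_tendsto hlim ?_
      filter_upwards [hlim.eventually hU, self_mem_nhdsWithin] with s hs hs0
      refine (hc _ hs).2 ?_
      have hRe : c.R e = WithLp.toLp 2 (0, 1) := c.R.apply_symm_apply _
      have h3 : (c.R (x + s • e)).fst = (c.R x).fst := by simp [hRe]
      have h4 : (c.R (x + s • e)).snd = (c.R x).snd + s := by simp [hRe]
      rw [h3, h4, h]
      exact lt_add_of_pos_right _ hs0
    · exact ((hc x hx).1 (interior_subset h2)).ne h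

theorem ae_differentiableAt (hc : c.IsChartOf Ω) :
    ∀ᵐ x ∂(boundaryMeasure Ω), x ∈ c.U → DifferentiableAt ℝ c.φ (c.R x).fst := by
  have h := c.ae_differentiableAt_of_range
  rw [ae_restrict_iff' c.measurableEmbedding_param.measurableSet_range] at h
  rw [boundaryMeasure, ae_restrict_iff' isClosed_frontier.measurableSet]
  filter_upwards [h] with x hx hxf hxU
  exact hx ((mem_frontier_iff hc hxU).1 hxf)

/-- The divergence theorem for vector fields supported in the domain of a chart. -/
theorem integral_divergence_of_tsupport_subset (hΩ : IsOpen Ω) (hc : c.IsChartOf Ω)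
    {u : Euc (d + 1) → Euc (d + 1)} (hu : ContDiff ℝ 1 u) (huc : HasCompactSupport u)
    (hsupp : tsupport u ⊆ c.U) :
    ∫ x in Ω, divergence u x = -∫ x, ⟪u x, c.normal x⟫ ∂(boundaryMeasure Ω) := by
  classical
  have hdiv : ∀ x, x ∉ c.U → divergence u x = 0 := fun x hx => by
    have : fderiv ℝ u x = 0 := by
      by_contra h
      exact hx (hsupp (support_fderiv_subset ℝ h))
    simp [divergence, this]
  have h1 : ∫ x in Ω, divergence u x = ∫ x in c.epigraph, divergence u x := by
    rw [← integral_indicator hΩ.measurableSet, ← integral_indicator c.measurableSet_epigraph]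
    congr 1
    ext x
    by_cases hx : x ∈ c.U
    · by_cases hxΩ : x ∈ Ω
      · have h : x ∈ c.epigraph := (hc x hx).1 hxΩ
        rw [indicator_of_mem hxΩ, indicator_of_mem h]
      · have h : x ∉ c.epigraph := fun h => hxΩ ((hc x hx).2 h)
        rw [indicator_of_notMem hxΩ, indicator_of_notMem h]
    · simp [indicator_apply, hdiv x hx]
  rw [h1, c.integral_divergence_epigraph hu huc, boundaryMeasure,
    ← integral_indicator c.measurableEmbedding_param.measurableSet_range,
    ← integral_indicator isClosed_frontier.measurableSet]
  congr 2
  ext x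
  by_cases hx : x ∈ c.U
  · have := mem_frontier_iff hc hx
    by_cases hxf : x ∈ frontier Ω
    · rw [indicator_of_mem hxf, indicator_of_mem (this.1 hxf)]
    · rw [indicator_of_notMem hxf, indicator_of_notMem fun h => hxf (this.2 h)]
  · have : u x = 0 := image_eq_zero_of_notMem_tsupport fun h => hx (hsupp h)
    simp [indicator_apply, this]

end LipschitzChart

/-! ### Pointwise normals -/

/-- `n` is an inner normal of `Ω` at `x` in the weak sense that every ray from `x` entering the
open half-space of inner normal `n` starts inside `Ω`, and every opposite ray starts outside. -/
def IsRayNormal {n : ℕ} (Ω : Set (Euc n)) (x ν : Euc n) : Prop :=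
  ∀ v, (0 < ⟪ν, v⟫ → ∀ᶠ s in 𝓝[>] (0 : ℝ), x + s • v ∈ Ω) ∧
    (⟪ν, v⟫ < 0 → ∀ᶠ s in 𝓝[>] (0 : ℝ), x + s • v ∉ Ω)

theorem IsRayNormal.unique {n : ℕ} {Ω : Set (Euc n)} {x ν ν' : Euc n} (h : IsRayNormal Ω x ν)
    (h' : IsRayNormal Ω x ν') (hν : ‖ν‖ = 1) (hν' : ‖ν'‖ = 1) : ν = ν' := by
  by_contra hne
  have hlt : ⟪ν, ν'⟫ < 1 := (inner_lt_one_iff_real_of_norm_eq_one hν hν').2 hne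
  have h1 : 0 < ⟪ν, ν - ν'⟫ := by
    rw [inner_sub_right, real_inner_self_eq_norm_sq, hν]; linarith
  have h2 : ⟪ν', ν - ν'⟫ < 0 := by
    rw [inner_sub_right, real_inner_self_eq_norm_sq, hν', real_inner_comm]; linarith
  obtain ⟨s, hs, hs'⟩ := (((h (ν - ν')).1 h1).and ((h' (ν - ν')).2 h2)).exists
  exact hs' hs

theorem LipschitzChart.isRayNormal {d : ℕ} {c : LipschitzChart d} {Ω : Set (Euc (d + 1))}
    (hc : c.IsChartOf Ω) {x : Euc (d + 1)} (hx : x ∈ c.U) (hxf : x ∈ frontier Ω)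
    (hd : DifferentiableAt ℝ c.φ (c.R x).fst) : IsRayNormal Ω x (c.normal x) := by
  intro v
  set g : ℝ → ℝ := fun s => (c.R (x + s • v)).snd - c.φ (c.R (x + s • v)).fst with hg
  have hJ := one_le_graphJacobian (fderiv ℝ c.φ (c.R x).fst)
  have hg0 : g 0 = 0 := by
    have := c.mem_range_param.1 ((mem_frontier_iff hc hx).1 hxf)
    simp [hg, this]
  have hgd : HasDerivAt g (graphJacobian (fderiv ℝ c.φ (c.R x).fst) * ⟪c.normal x, v⟫) 0 := by
    rw [← real_inner_smul_left, c.smul_normal, c.inner_conormal]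
    have e1 : ∀ s : ℝ, (c.R (x + s • v)).fst = (c.R x).fst + s • (c.R v).fst := fun s => by simp
    have e2 : ∀ s : ℝ, (c.R (x + s • v)).snd = (c.R x).snd + s * (c.R v).snd := fun s => by simp
    simp only [hg, e1, e2]
    have h1 : HasDerivAt (fun s : ℝ => (c.R x).snd + s * (c.R v).snd) (c.R v).snd 0 := by
      simpa using ((hasDerivAt_id (0 : ℝ)).mul_const (c.R v).snd).const_add (c.R x).snd
    have h2 : HasDerivAt (fun s : ℝ => (c.R x).fst + s • (c.R v).fst) (c.R v).fst 0 := by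
      simpa using ((hasDerivAt_id (0 : ℝ)).smul_const (c.R v).fst).const_add (c.R x).fst
    have h3 : HasFDerivAt c.φ (fderiv ℝ c.φ (c.R x).fst) ((c.R x).fst + (0 : ℝ) • (c.R v).fst) := by
      simpa using hd.hasFDerivAt
    exact h1.sub (h3.comp_hasDerivAt (0 : ℝ) h2)
  have hslope := (hasDerivAt_iff_tendsto_slope.1 hgd).mono_left
    (nhdsWithin_mono 0 (fun s hs => ne_of_gt hs : Ioi (0 : ℝ) ⊆ {0}ᶜ))
  have hU : ∀ᶠ s in 𝓝[>] (0 : ℝ), x + s • v ∈ c.U := by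
    have h1 : Continuous fun s : ℝ => x + s • v := by fun_prop
    refine ((h1.tendsto 0).mono_left nhdsWithin_le_nhds).eventually (c.isOpen_U.mem_nhds ?_)
    simpa using hx
  constructor
  · intro hv
    filter_upwards [hslope.eventually_const_lt (mul_pos (zero_lt_one.trans_le hJ) hv), hU,
      self_mem_nhdsWithin] with s hs hsU hs0
    rw [slope_def_field, hg0, sub_zero, sub_zero] at hs
    refine (hc _ hsU).2 (sub_pos.1 ?_)
    exact (div_pos_iff_of_pos_right hs0).1 hs
  · intro hv
    filter_upwards [hslope.eventually_lt_const
      (mul_neg_of_pos_of_neg (zero_lt_one.trans_le hJ) hv), hU,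
      self_mem_nhdsWithin] with s hs hsU hs0
    rw [slope_def_field, hg0, sub_zero, sub_zero] at hs
    intro hmem
    have := (div_neg_iff.1 hs)
    have h5 : 0 < g s := sub_pos.2 ((hc _ hsU).1 hmem)
    have h6 : (0 : ℝ) < s := hs0
    rcases this with h | h <;> linarith

theorem IsNecasNormal.isRayNormal {d : ℕ} {Ω : Set (Euc (d + 1))} {x ν : Euc (d + 1)}
    (h : IsNecasNormal Ω x ν) : IsRayNormal Ω x ν := by
  obtain ⟨hxf, c, hc, hx, hd, rfl⟩ := h
  exact LipschitzChart.isRayNormal hc hx hxf hd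

theorem IsNecasNormal.norm_eq_one {d : ℕ} {Ω : Set (Euc (d + 1))} {x ν : Euc (d + 1)}
    (h : IsNecasNormal Ω x ν) : ‖ν‖ = 1 := by
  obtain ⟨hxf, c, hc, hx, hd, rfl⟩ := h
  exact c.norm_normal x

/-- The chart normal does not depend on the chart. -/
theorem IsNecasNormal.unique {d : ℕ} {Ω : Set (Euc (d + 1))} {x ν ν' : Euc (d + 1)}
    (h : IsNecasNormal Ω x ν) (h' : IsNecasNormal Ω x ν') : ν = ν' :=
  h.isRayNormal.unique h'.isRayNormal h.norm_eq_one h'.norm_eq_one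

theorem isNecasNormal_necasNormal {d : ℕ} {Ω : Set (Euc (d + 1))} {x : Euc (d + 1)}
    (h : ∃ v, IsNecasNormal Ω x v) : IsNecasNormal Ω x (necasNormal Ω x) := by
  rw [necasNormal, dif_pos h]
  exact h.choose_spec

theorem IsNecasNormal.necasNormal_eq {d : ℕ} {Ω : Set (Euc (d + 1))} {x ν : Euc (d + 1)}
    (h : IsNecasNormal Ω x ν) : necasNormal Ω x = ν :=
  (isNecasNormal_necasNormal ⟨ν, h⟩).unique h

theorem LipschitzChart.ae_isNecasNormal {d : ℕ} {c : LipschitzChart d} {Ω : Set (Euc (d + 1))}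
    (hc : c.IsChartOf Ω) :
    ∀ᵐ x ∂(boundaryMeasure Ω), x ∈ c.U →
      DifferentiableAt ℝ c.φ (c.R x).fst ∧ IsNecasNormal Ω x (c.normal x) := by
  filter_upwards [c.ae_differentiableAt hc, ae_restrict_mem isClosed_frontier.measurableSet]
    with x hx hxf hxU
  exact ⟨hx hxU, hxf, c, hc, hxU, hx hxU, rfl⟩

/-- The blow-up of a set at a point with a ray normal is a half-space. -/
theorem IsRayNormal.tendsto_blowup {n : ℕ} {Ω : Set (Euc n)} (hΩ : MeasurableSet Ω)
    {x ν : Euc n} (hν : ‖ν‖ = 1) (h : IsRayNormal Ω x ν) :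
    Tendsto (fun r : ℝ => volume.real ((Ω ∆ {y | 0 < ⟪y - x, ν⟫}) ∩ Metric.ball x r) / r ^ n)
      (𝓝[>] 0) (𝓝 0) := by
  classical
  set H : Set (Euc n) := {y | 0 < ⟪y - x, ν⟫} with hH
  have hHm : MeasurableSet H :=
    (isOpen_lt continuous_const (by fun_prop)).measurableSet
  set G : ℝ → Euc n → ℝ := fun r z =>
    (Metric.ball (0 : Euc n) 1).indicator (fun z => (Ω ∆ H).indicator (fun _ => (1 : ℝ)) (x + r • z)) z
    with hG
  have hmap : ∀ r : ℝ, Measurable fun z : Euc n => x + r • z := fun r => by fun_prop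
  have hGm : ∀ r, Measurable (G r) := fun r =>
    (((measurable_const.indicator (hΩ.symmDiff hHm)).comp (hmap r))).indicator
      Metric.isOpen_ball.measurableSet
  have hscale : ∀ r > 0, ∫ z, G r z = volume.real ((Ω ∆ H) ∩ Metric.ball x r) / r ^ n := by
    intro r hr
    set g : Euc n → ℝ := ((Ω ∆ H) ∩ Metric.ball x r).indicator (fun _ => (1 : ℝ)) with hgdef
    have hGg : ∀ z, G r z = g (x + r • z) := by
      intro z
      have : x + r • z ∈ Metric.ball x r ↔ z ∈ Metric.ball (0 : Euc n) 1 := by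
        rw [mem_ball_iff_norm, mem_ball_zero_iff, add_sub_cancel_left, norm_smul,
          Real.norm_of_nonneg hr.le]
        constructor
        · intro h; by_contra! h2; nlinarith
        · intro h; nlinarith
      simp only [hG, hgdef, indicator_apply, mem_inter_iff, this]
      by_cases h1 : z ∈ Metric.ball (0 : Euc n) 1 <;> simp [h1]
    simp_rw [hGg]
    have h1 := Measure.integral_comp_smul (volume : Measure (Euc n)) (fun z => g (x + z)) r
    rw [h1, integral_add_left_eq_self, hgdef,
      integral_indicator ((hΩ.symmDiff hHm).inter Metric.isOpen_ball.measurableSet)]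
    simp only [finrank_euclideanSpace_fin, smul_eq_mul, setIntegral_const, mul_one]
    rw [abs_of_pos (by positivity)]
    ring
  have hlim : Tendsto (fun r => ∫ z, G r z) (𝓝[>] 0) (𝓝 (∫ _ : Euc n, (0 : ℝ))) := by
    refine tendsto_integral_filter_of_dominated_convergence
      ((Metric.ball (0 : Euc n) 1).indicator fun _ => (1 : ℝ)) ?_ ?_ ?_ ?_
    · exact Eventually.of_forall fun r => (hGm r).aestronglyMeasurable
    · refine Eventually.of_forall fun r => Eventually.of_forall fun z => ?_
      simp only [hG, indicator_apply]
      split_ifs <;> simp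
    · exact (integrable_indicator_iff Metric.isOpen_ball.measurableSet).2
        (integrableOn_const measure_ball_lt_top.ne)
    · have hnull : ∀ᵐ z : Euc n, ⟪ν, z⟫ ≠ 0 := by
        have hne : (ℝ ∙ ν)ᗮ ≠ ⊤ := by
          intro htop
          have : ν ∈ (ℝ ∙ ν)ᗮ := htop ▸ Submodule.mem_top
          rw [Submodule.mem_orthogonal_singleton_iff_inner_right,
            real_inner_self_eq_norm_sq, hν] at this
          norm_num at this
        refine measure_mono_null (fun z hz => ?_)
          (Measure.addHaar_submodule volume ((ℝ ∙ ν)ᗮ) hne)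
        have hz' : ⟪ν, z⟫ = 0 := not_not.1 hz
        exact Submodule.mem_orthogonal_singleton_iff_inner_right.2 hz'
      filter_upwards [hnull] with z hz
      refine tendsto_const_nhds.congr' ?_
      have hinn : ∀ s : ℝ, ⟪x + s • z - x, ν⟫ = s * ⟪ν, z⟫ := fun s => by
        rw [add_sub_cancel_left, real_inner_smul_left, real_inner_comm]
      rcases lt_or_gt_of_ne hz with hneg | hpos
      · filter_upwards [(h z).2 hneg, self_mem_nhdsWithin] with s hs hs0
        have hs0' : (0 : ℝ) < s := hs0
        have h1 : x + s • z ∉ H := by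
          simp only [hH, mem_ofPred_eq, hinn, not_lt]; nlinarith
        have h2 : x + s • z ∉ Ω ∆ H := by simp [mem_symmDiff, hs, h1]
        simp [hG, indicator_apply, h2]
      · filter_upwards [(h z).1 hpos, self_mem_nhdsWithin] with s hs hs0
        have hs0' : (0 : ℝ) < s := hs0
        have h1 : x + s • z ∈ H := by
          simp only [hH, mem_ofPred_eq, hinn]; positivity
        have h2 : x + s • z ∉ Ω ∆ H := by simp [mem_symmDiff, hs, h1]
        simp [hG, indicator_apply, h2]
  rw [integral_zero] at hlim
  refine hlim.congr' ?_
  filter_upwards [self_mem_nhdsWithin] with r hr using hscale r hr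

/-! ### The divergence -/

theorem divergence_add {n : ℕ} {u v : Euc n → Euc n} (hu : Differentiable ℝ u)
    (hv : Differentiable ℝ v) (x : Euc n) :
    divergence (fun x => u x + v x) x = divergence u x + divergence v x := by
  simp only [divergence, fderiv_fun_add (hu x) (hv x), add_apply, PiLp.add_apply,
    Finset.sum_add_distrib]

theorem divergence_sum {n : ℕ} {ι : Type*} (s : Finset ι) {u : ι → Euc n → Euc n}
    (hu : ∀ i ∈ s, Differentiable ℝ (u i)) (x : Euc n) :
    divergence (fun x => ∑ i ∈ s, u i x) x = ∑ i ∈ s, divergence (u i) x := by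
  simp only [divergence, fderiv_fun_sum fun i hi => hu i hi x]
  rw [Finset.sum_comm]
  simp

theorem divergence_eq_zero_of_notMem_tsupport {n : ℕ} {u : Euc n → Euc n} {x : Euc n}
    (hx : x ∉ tsupport u) : divergence u x = 0 := by
  have : fderiv ℝ u x = 0 := by
    by_contra h
    exact hx (support_fderiv_subset ℝ h)
  simp [divergence, this]

theorem norm_divergence_le {n : ℕ} (u : Euc n → Euc n) (x : Euc n) :
    ‖divergence u x‖ ≤ n * ‖fderiv ℝ u x‖ := by
  refine (norm_sum_le _ _).trans ?_
  have : ∀ i ∈ (Finset.univ : Finset (Fin n)),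
      ‖(fderiv ℝ u x (EuclideanSpace.single i 1)) i‖ ≤ ‖fderiv ℝ u x‖ := fun i _ => by
    refine (PiLp.norm_apply_le _ i).trans ?_
    refine (ContinuousLinearMap.le_opNorm _ _).trans ?_
    simp
  simpa using Finset.sum_le_sum this

theorem integrable_divergence {n : ℕ} {u : Euc n → Euc n} (hu : ContDiff ℝ 1 u)
    (huc : HasCompactSupport u) : Integrable (divergence u) := by
  refine Continuous.integrable_of_hasCompactSupport ?_ ?_
  · have := hu.continuous_fderiv one_ne_zero
    unfold divergence
    fun_prop
  · exact HasCompactSupport.intro huc fun x hx => divergence_eq_zero_of_notMem_tsupport hx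

theorem integral_divergence_eq_zero {n : ℕ} {u : Euc n → Euc n} (hu : ContDiff ℝ 1 u)
    (huc : HasCompactSupport u) : ∫ x, divergence u x = 0 := by
  have hui : ∀ i, ContDiff ℝ 1 fun x => u x i := fun i => by fun_prop
  have huci : ∀ i, HasCompactSupport fun x => u x i := fun i =>
    huc.comp_left (g := fun z : Euc n => z i) rfl
  simp_rw [divergence_eq_sum (hu.differentiable one_ne_zero)]
  rw [integral_finsetSum _ fun i _ => (((hui i).continuous_fderiv one_ne_zero).clm_apply
      continuous_const).integrable_of_hasCompactSupport ((huci i).fderiv_apply ℝ _)]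
  refine Finset.sum_eq_zero fun i _ => ?_
  obtain ⟨C, hC⟩ := (hui i).lipschitzWith_of_hasCompactSupport (huci i) one_ne_zero
  rw [← integral_lineDeriv_eq_zero (μ := volume) hC (huci i) (EuclideanSpace.single i 1)]
  refine integral_congr_ae (Eventually.of_forall fun x => ?_)
  exact ((hui i).differentiable one_ne_zero x).lineDeriv_eq_fderiv.symm

/-- Vector fields supported off the boundary of `Ω` have zero total divergence in `Ω`. -/
theorem setIntegral_divergence_eq_zero {n : ℕ} {Ω : Set (Euc n)} (hΩ : IsOpen Ω)
    {u : Euc n → Euc n} (hu : ContDiff ℝ 1 u) (huc : HasCompactSupport u)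
    (hsupp : tsupport u ⊆ (frontier Ω)ᶜ) : ∫ x in Ω, divergence u x = 0 := by
  have hloc : ∀ x, Ω.indicator u =ᶠ[𝓝 x] u ∧ Ω.indicator (divergence u) x = divergence u x ∨
      Ω.indicator u =ᶠ[𝓝 x] 0 ∧ Ω.indicator (divergence u) x = 0 := by
    intro x
    by_cases hx : x ∈ tsupport u
    · have hxf := hsupp hx
      by_cases hxΩ : x ∈ Ω
      · left
        refine ⟨?_, indicator_of_mem hxΩ _⟩
        filter_upwards [hΩ.mem_nhds hxΩ] with y hy using indicator_of_mem hy _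
      · right
        refine ⟨?_, indicator_of_notMem hxΩ _⟩
        have hxc : x ∉ closure Ω := fun h => hxf ⟨h, fun h' => hxΩ (interior_subset h')⟩
        filter_upwards [isClosed_closure.isOpen_compl.mem_nhds hxc] with y hy
        exact indicator_of_notMem (fun h => hy (subset_closure h)) _
    · right
      have h0 := notMem_tsupport_iff_eventuallyEq.1 hx
      constructor
      · filter_upwards [h0] with y hy
        by_cases hyΩ : y ∈ Ω
        · rw [indicator_of_mem hyΩ, hy]
        · rw [indicator_of_notMem hyΩ]; rfl
      · by_cases hxΩ : x ∈ Ω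
        · rw [indicator_of_mem hxΩ, divergence_eq_zero_of_notMem_tsupport hx]
        · rw [indicator_of_notMem hxΩ]
  have hw : ContDiff ℝ 1 (Ω.indicator u) := contDiff_iff_contDiffAt.2 fun x => by
    rcases hloc x with h | h
    · exact hu.contDiffAt.congr_of_eventuallyEq h.1
    · exact contDiffAt_const.congr_of_eventuallyEq h.1
  have hwc : HasCompactSupport (Ω.indicator u) := huc.mono (by
    rw [support_indicator]; exact inter_subset_right)
  rw [← integral_indicator hΩ.measurableSet, ← integral_divergence_eq_zero hw hwc]
  congr 1
  ext x
  rcases hloc x with h | h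
  · rw [h.2, divergence, divergence, h.1.fderiv_eq]
  · rw [h.2, divergence, h.1.fderiv_eq]
    simp

/-! ### Existence and measurability of the chart normal -/

section Global

variable {d : ℕ} {Ω : Set (Euc (d + 1))}

theorem exists_countable_charts {S : Set (Euc (d + 1))} (hS : boundaryMeasure Ω S = 0)
    (hL : ∀ x ∈ frontier Ω, x ∉ S → IsLipschitzAt Ω x) :
    ∃ T : Set (LipschitzChart d), T.Countable ∧ (∀ c ∈ T, c.IsChartOf Ω) ∧
      ∀ᵐ x ∂(boundaryMeasure Ω), x ∈ ⋃ c : T, c.1.U := by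
  obtain ⟨T, hT, hTU⟩ := TopologicalSpace.isOpen_iUnion_countable
    (fun c : {c : LipschitzChart d // c.IsChartOf Ω} => c.1.U) (fun c => c.1.isOpen_U)
  refine ⟨Subtype.val '' T, hT.image _, ?_, ?_⟩
  · rintro _ ⟨c, -, rfl⟩; exact c.2
  · filter_upwards [measure_eq_zero_iff_ae_notMem.1 hS,
      ae_restrict_mem isClosed_frontier.measurableSet] with x hxS hxf
    obtain ⟨c, hc, hxc⟩ := hL x hxf hxS
    have : x ∈ ⋃ c : {c : LipschitzChart d // c.IsChartOf Ω}, c.1.U := mem_iUnion.2 ⟨⟨c, hc⟩, hxc⟩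
    rw [← hTU] at this
    obtain ⟨c', hc', hx⟩ := mem_iUnion₂.1 this
    exact mem_iUnion.2 ⟨⟨c'.1, c', hc', rfl⟩, hx⟩

theorem ae_exists_isNecasNormal {S : Set (Euc (d + 1))} (hS : boundaryMeasure Ω S = 0)
    (hL : ∀ x ∈ frontier Ω, x ∉ S → IsLipschitzAt Ω x) :
    ∀ᵐ x ∂(boundaryMeasure Ω), ∃ v, IsNecasNormal Ω x v := by
  obtain ⟨T, hT, hTc, hTU⟩ := exists_countable_charts hS hL
  have h : ∀ᵐ x ∂(boundaryMeasure Ω), ∀ c ∈ T, x ∈ c.U →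
      DifferentiableAt ℝ c.φ (c.R x).fst ∧ IsNecasNormal Ω x (c.normal x) :=
    (ae_ball_iff hT).2 fun c hc => LipschitzChart.ae_isNecasNormal (hTc c hc)
  filter_upwards [h, hTU] with x hx hxU
  obtain ⟨c, hc⟩ := mem_iUnion.1 hxU
  exact ⟨_, (hx c c.2 hc).2⟩

theorem aestronglyMeasurable_necasNormal {S : Set (Euc (d + 1))} (hS : boundaryMeasure Ω S = 0)
    (hL : ∀ x ∈ frontier Ω, x ∉ S → IsLipschitzAt Ω x) :
    AEStronglyMeasurable (necasNormal Ω) (boundaryMeasure Ω) := by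
  obtain ⟨T, hT, hTc, hTU⟩ := exists_countable_charts hS hL
  have : Countable T := hT.to_subtype
  rw [← Measure.restrict_eq_self_of_ae_mem hTU, aestronglyMeasurable_iUnion_iff]
  intro c
  refine (c.1.measurable_normal.aestronglyMeasurable).congr ?_
  refine (ae_restrict_iff' c.1.isOpen_U.measurableSet).2 ?_
  filter_upwards [LipschitzChart.ae_isNecasNormal (hTc c c.2)] with x hx hxU
  exact (hx hxU).2.necasNormal_eq.symm

theorem ae_norm_necasNormal (h : ∀ᵐ x ∂(boundaryMeasure Ω), ∃ v, IsNecasNormal Ω x v) :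
    ∀ᵐ x ∂(boundaryMeasure Ω), ‖necasNormal Ω x‖ = 1 := by
  filter_upwards [h] with x hx using (isNecasNormal_necasNormal hx).norm_eq_one

/-! ### Stokes' formula for fields supported in a given set -/

/-- Stokes' formula holds for the vector fields supported in `W`. -/
def StokesOn (Ω W : Set (Euc (d + 1))) : Prop :=
  ∀ u : Euc (d + 1) → Euc (d + 1), ContDiff ℝ 1 u → HasCompactSupport u → tsupport u ⊆ W →
    ∫ x in Ω, divergence u x = - ∫ x, ⟪u x, necasNormal Ω x⟫ ∂(boundaryMeasure Ω)

theorem stokesOn_chart (hΩ : IsOpen Ω) {c : LipschitzChart d} (hc : c.IsChartOf Ω) :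
    StokesOn Ω c.U := by
  intro u hu huc hsupp
  rw [LipschitzChart.integral_divergence_of_tsupport_subset hΩ hc hu huc hsupp]
  congr 1
  refine integral_congr_ae ?_
  filter_upwards [LipschitzChart.ae_isNecasNormal hc] with x hx
  by_cases hxU : x ∈ c.U
  · rw [(hx hxU).2.necasNormal_eq]
  · have : u x = 0 := image_eq_zero_of_notMem_tsupport fun h => hxU (hsupp h)
    rw [this, inner_zero_left, inner_zero_left]

theorem stokesOn_compl_frontier (hΩ : IsOpen Ω) : StokesOn Ω (frontier Ω)ᶜ := by
  intro u hu huc hsupp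
  rw [setIntegral_divergence_eq_zero hΩ hu huc hsupp, integral_eq_zero_of_ae, neg_zero]
  filter_upwards [ae_restrict_mem isClosed_frontier.measurableSet] with x hx
  have : u x = 0 := image_eq_zero_of_notMem_tsupport fun h => hsupp h hx
  simp [this]

theorem integrable_inner_necasNormal [IsFiniteMeasure (boundaryMeasure Ω)]
    (hm : AEStronglyMeasurable (necasNormal Ω) (boundaryMeasure Ω))
    (hn : ∀ᵐ x ∂(boundaryMeasure Ω), ‖necasNormal Ω x‖ = 1)
    {u : Euc (d + 1) → Euc (d + 1)} (hu : Continuous u) (huc : HasCompactSupport u) :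
    Integrable (fun x => ⟪u x, necasNormal Ω x⟫) (boundaryMeasure Ω) := by
  refine (hu.integrable_of_hasCompactSupport huc).norm.mono'
    (hu.aestronglyMeasurable.inner hm) ?_
  filter_upwards [hn] with x hx
  simpa [hx] using norm_inner_le_norm (𝕜 := ℝ) (u x) (necasNormal Ω x)

open scoped Manifold ContDiff in
theorem exists_contDiff_partition {n : ℕ} {K : Set (Euc n)} (hK : IsClosed K) {ι : Type*}
    [Fintype ι] {V : ι → Set (Euc n)} (hV : ∀ i, IsOpen (V i)) (hKV : K ⊆ ⋃ i, V i) :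
    ∃ f : ι → Euc n → ℝ, (∀ i, ContDiff ℝ 1 (f i)) ∧ (∀ i, tsupport (f i) ⊆ V i) ∧
      ∀ x ∈ K, ∑ i, f i x = 1 := by
  obtain ⟨f, hf⟩ := SmoothPartitionOfUnity.exists_isSubordinate 𝓘(ℝ, Euc n) hK V hV hKV
  refine ⟨fun i => f i, fun i => ?_, hf, fun x hx => ?_⟩
  · exact (f i).contMDiff.contDiff.of_le (by exact_mod_cast le_top)
  · rw [← finsum_eq_sum_of_fintype]
    exact f.sum_eq_one hx

theorem stokesOn_of_locally [IsFiniteMeasure (boundaryMeasure Ω)]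
    (hm : AEStronglyMeasurable (necasNormal Ω) (boundaryMeasure Ω))
    (hn : ∀ᵐ x ∂(boundaryMeasure Ω), ‖necasNormal Ω x‖ = 1) {W : Set (Euc (d + 1))}
    (h : ∀ x ∈ W, ∃ V, IsOpen V ∧ x ∈ V ∧ StokesOn Ω V) : StokesOn Ω W := by
  intro u hu huc hsupp
  choose! V hVo hxV hV using h
  obtain ⟨t, htW, ht⟩ := huc.isCompact.elim_nhds_subcover V
    fun x hx => (hVo x (hsupp hx)).mem_nhds (hxV x (hsupp hx))
  obtain ⟨f, hfd, hf, hf1⟩ := exists_contDiff_partition (isClosed_tsupport u)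
    (V := fun x : t => V x) (fun x => hVo x (hsupp (htW x x.2))) (by rwa [iUnion_subtype])
  have hfu : ∀ i, ContDiff ℝ 1 fun x => f i x • u x := fun i => (hfd i).smul hu
  have hfc : ∀ i, HasCompactSupport fun x => f i x • u x := fun i =>
    HasCompactSupport.intro huc fun x hx => by rw [image_eq_zero_of_notMem_tsupport hx, smul_zero]
  have hfs : ∀ i, tsupport (fun x => f i x • u x) ⊆ V i := fun i =>
    (tsupport_smul_subset_left (f i) u).trans (hf i)
  have hsum : ∀ x, ∑ i, f i x • u x = u x := by
    intro x
    by_cases hx : x ∈ tsupport u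
    · rw [← Finset.sum_smul, hf1 x hx, one_smul]
    · simp [image_eq_zero_of_notMem_tsupport hx]
  have hdiv : ∀ x, divergence u x = ∑ i, divergence (fun x => f i x • u x) x := by
    intro x
    rw [← divergence_sum _ fun i _ => (hfu i).differentiable one_ne_zero]
    simp_rw [hsum]
  have hinn : ∀ x, ⟪u x, necasNormal Ω x⟫ = ∑ i, ⟪f i x • u x, necasNormal Ω x⟫ := by
    intro x
    rw [← sum_inner, hsum]
  simp_rw [hdiv, hinn]
  rw [integral_finsetSum _ fun i _ => (integrable_divergence (hfu i) (hfc i)).integrableOn,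
    integral_finsetSum _ fun i _ =>
      integrable_inner_necasNormal hm hn (hfu i).continuous (hfc i), ← Finset.sum_neg_distrib]
  exact Finset.sum_congr rfl fun i _ => hV i (hsupp (htW i i.2)) _ (hfu i) (hfc i) (hfs i)

end Global

/-! ### Removal of finitely many points -/

theorem exists_cutoff {n : ℕ} (p : Euc n) : ∃ (ψ : ℝ → Euc n → ℝ) (C : ℝ),
    (∀ r, ContDiff ℝ 1 (ψ r)) ∧ (∀ r x, 0 ≤ ψ r x ∧ ψ r x ≤ 1) ∧
    (∀ r > 0, ψ r =ᶠ[𝓝 p] 1) ∧ (∀ r > 0, tsupport (ψ r) ⊆ Metric.closedBall p (2 * r)) ∧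
    (∀ r > 0, ∀ x, ‖fderiv ℝ (ψ r) x‖ ≤ C / r) := by
  let b : ContDiffBump (0 : Euc n) := ⟨1, 2, by norm_num, by norm_num⟩
  have hb : ContDiff ℝ 1 b := b.contDiff
  obtain ⟨C, hC⟩ := hb.lipschitzWith_of_hasCompactSupport b.hasCompactSupport one_ne_zero
  have hcd : ∀ r : ℝ, ContDiff ℝ 1 fun x => b (r⁻¹ • (x - p)) := fun r =>
    hb.comp (by fun_prop)
  refine ⟨fun r x => b (r⁻¹ • (x - p)), C, hcd, fun r x => ⟨b.nonneg, b.le_one⟩, ?_, ?_, ?_⟩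
  · intro r hr
    have hcont : Continuous fun x : Euc n => r⁻¹ • (x - p) := by fun_prop
    have : Tendsto (fun x : Euc n => r⁻¹ • (x - p)) (𝓝 p) (𝓝 0) := by
      simpa using hcont.tendsto p
    exact this.eventually b.eventuallyEq_one
  · intro r hr
    refine closure_minimal (fun x hx => ?_) Metric.isClosed_closedBall
    have h1 : r⁻¹ • (x - p) ∈ Function.support b := hx
    rw [b.support_eq, mem_ball_zero_iff, norm_smul, norm_inv, Real.norm_of_nonneg hr.le,
      inv_mul_lt_iff₀ hr] at h1
    rw [mem_closedBall_iff_norm, mul_comm]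
    exact h1.le
  · intro r hr x
    have hl : LipschitzWith (C * ‖r⁻¹‖₊) fun x => b (r⁻¹ • (x - p)) :=
      hC.comp (LipschitzWith.of_dist_le_mul fun x y => by
        rw [dist_smul₀, dist_sub_right]; rfl)
    refine (norm_fderiv_le_of_lipschitz ℝ hl).trans_eq ?_
    simp [abs_of_pos hr, div_eq_mul_inv]

section Global

variable {d : ℕ} {Ω : Set (Euc (d + 1))}

theorem stokesOn_of_punctured (hd : 1 ≤ d) (hΩ : IsOpen Ω) [IsFiniteMeasure (boundaryMeasure Ω)]
    (hm : AEStronglyMeasurable (necasNormal Ω) (boundaryMeasure Ω))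
    (hn : ∀ᵐ x ∂(boundaryMeasure Ω), ‖necasNormal Ω x‖ = 1) {W : Set (Euc (d + 1))}
    {p : Euc (d + 1)} (hp : boundaryMeasure Ω {p} = 0) (h : StokesOn Ω (W \ {p})) :
    StokesOn Ω W := by
  intro u hu huc hsupp
  obtain ⟨ψ, C, hψd, hψ01, hψ1, hψs, hψC⟩ := exists_cutoff p
  set v : ℝ → Euc (d + 1) → Euc (d + 1) := fun r x => ψ r x • u x with hv
  set w : ℝ → Euc (d + 1) → Euc (d + 1) := fun r x => (1 - ψ r x) • u x with hw
  have hvd : ∀ r, ContDiff ℝ 1 (v r) := fun r => (hψd r).smul hu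
  have hwd : ∀ r, ContDiff ℝ 1 (w r) := fun r => (contDiff_const.sub (hψd r)).smul hu
  have hvc : ∀ r, HasCompactSupport (v r) := fun r => HasCompactSupport.intro huc fun x hx => by
    simp [hv, image_eq_zero_of_notMem_tsupport hx]
  have hwc : ∀ r, HasCompactSupport (w r) := fun r => HasCompactSupport.intro huc fun x hx => by
    simp [hw, image_eq_zero_of_notMem_tsupport hx]
  have huvw : ∀ r x, u x = w r x + v r x := fun r x => by
    simp only [hv, hw, ← add_smul, sub_add_cancel, one_smul]
  have hws : ∀ r > 0, tsupport (w r) ⊆ W \ {p} := by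
    intro r hr x hx
    refine ⟨hsupp (tsupport_smul_subset_right _ _ hx), ?_⟩
    rintro rfl
    refine notMem_tsupport_iff_eventuallyEq.2 ?_ hx
    filter_upwards [hψ1 r hr] with y hy
    simp [hw, hy]
  have hkey : ∀ r > 0, (∫ x in Ω, divergence u x) +
      ∫ x, ⟪u x, necasNormal Ω x⟫ ∂(boundaryMeasure Ω) = (∫ x in Ω, divergence (v r) x) +
        ∫ x, ⟪v r x, necasNormal Ω x⟫ ∂(boundaryMeasure Ω) := by
    intro r hr
    have h1 : ∀ x, divergence u x = divergence (w r) x + divergence (v r) x := fun x => by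
      rw [← divergence_add ((hwd r).differentiable one_ne_zero)
        ((hvd r).differentiable one_ne_zero)]
      simp_rw [← huvw]
    have h2 : ∀ x, ⟪u x, necasNormal Ω x⟫ =
        ⟪w r x, necasNormal Ω x⟫ + ⟪v r x, necasNormal Ω x⟫ := fun x => by
      rw [← inner_add_left, ← huvw]
    simp_rw [h1, h2]
    rw [integral_add (integrable_divergence (hwd r) (hwc r)).integrableOn
        (integrable_divergence (hvd r) (hvc r)).integrableOn,
      integral_add (integrable_inner_necasNormal hm hn (hwd r).continuous (hwc r))
        (integrable_inner_necasNormal hm hn (hvd r).continuous (hvc r)),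
      h _ (hwd r) (hwc r) (hws r hr)]
    ring
  have hvzero : ∀ r > 0, ∀ x, x ∉ Metric.closedBall p (2 * r) → x ∉ tsupport (v r) :=
    fun r hr x hx hxt => hx (hψs r hr (tsupport_smul_subset_left _ _ hxt))
  have hlim1 : Tendsto (fun r => ∫ x in Ω, divergence (v r) x) (𝓝[>] 0) (𝓝 0) := by
    obtain ⟨A, hA⟩ := hu.continuous.bounded_above_of_compact_support huc
    obtain ⟨B, hB⟩ := (hu.continuous_fderiv one_ne_zero).bounded_above_of_compact_support
      (huc.fderiv ℝ)
    set M : ℝ := volume.real (Metric.ball (0 : Euc (d + 1)) 1)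
    have hbound : ∀ r ∈ Ioi (0 : ℝ), ‖∫ x in Ω, divergence (v r) x‖ ≤
        ((d + 1 : ℕ) * (C / r * A + B)) * ((2 * r) ^ (d + 1) * M) := by
      intro r hr
      have hr : 0 < r := hr
      have hpt : ∀ x, ‖divergence (v r) x‖ ≤ (d + 1 : ℕ) * (C / r * A + B) := by
        intro x
        refine (norm_divergence_le _ _).trans ?_
        gcongr
        rw [hv, fderiv_fun_smul ((hψd r).differentiable one_ne_zero x)
          (hu.differentiable one_ne_zero x)]
        refine (norm_add_le _ _).trans ?_
        rw [add_comm, norm_smul, ContinuousLinearMap.norm_smulRight_apply]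
        have h0 := hψ01 r x
        have hC0 : 0 ≤ C / r := (norm_nonneg _).trans (hψC r hr x)
        refine add_le_add (mul_le_mul (hψC r hr x) (hA x) (norm_nonneg _) hC0) ?_
        rw [Real.norm_of_nonneg h0.1]
        exact (mul_le_of_le_one_left (norm_nonneg _) h0.2).trans (hB x)
      have heq : ∫ x in Ω, divergence (v r) x =
          ∫ x in Ω ∩ Metric.closedBall p (2 * r), divergence (v r) x :=
        setIntegral_eq_of_subset_of_forall_sdiff_eq_zero hΩ.measurableSet inter_subset_left
          fun x hx => divergence_eq_zero_of_notMem_tsupport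
            (hvzero r hr x fun hxb => hx.2 ⟨hx.1, hxb⟩)
      rw [heq]
      have hfin : volume (Metric.closedBall p (2 * r)) < ⊤ := measure_closedBall_lt_top
      have hvol : volume.real (Metric.closedBall p (2 * r)) = (2 * r) ^ (d + 1) * M := by
        rw [measureReal_def, Measure.addHaar_closedBall _ _ (by positivity), ENNReal.toReal_mul,
          ENNReal.toReal_ofReal (by positivity), finrank_euclideanSpace_fin]
        rfl
      have hfin' : volume (Ω ∩ Metric.closedBall p (2 * r)) < ⊤ :=
        (measure_mono inter_subset_right).trans_lt hfin
      refine (norm_setIntegral_le_of_norm_le_const hfin' fun x _ => hpt x).trans ?_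
      rw [← hvol]
      have h0 : 0 ≤ (d + 1 : ℕ) * (C / r * A + B) := (norm_nonneg _).trans (hpt p)
      exact mul_le_mul_of_nonneg_left (measureReal_mono inter_subset_right hfin.ne) h0
    refine squeeze_zero_norm' (eventually_nhdsWithin_of_forall hbound) ?_
    have hcont : Continuous fun r : ℝ =>
        ((d + 1 : ℕ) * (C * A + B * r)) * (2 ^ (d + 1) * r ^ d * M) := by fun_prop
    have h0 := (hcont.tendsto 0).mono_left (nhdsWithin_le_nhds (s := Ioi 0))
    rw [zero_pow (by omega)] at h0
    simp only [mul_zero, zero_mul] at h0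
    refine h0.congr' ?_
    filter_upwards [self_mem_nhdsWithin] with r hr
    have hr : r ≠ 0 := ne_of_gt hr
    rw [mul_pow, pow_succ r d]
    field_simp
  have hlim2 : Tendsto (fun r => ∫ x, ⟪v r x, necasNormal Ω x⟫ ∂(boundaryMeasure Ω))
      (𝓝[>] 0) (𝓝 0) := by
    suffices Tendsto (fun r => ∫ x, ⟪v r x, necasNormal Ω x⟫ ∂(boundaryMeasure Ω))
        (𝓝[>] 0) (𝓝 (∫ _, (0 : ℝ) ∂(boundaryMeasure Ω))) by simpa using this
    refine tendsto_integral_filter_of_dominated_convergence (fun x => ‖u x‖)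
      (Eventually.of_forall fun r => (hvd r).continuous.aestronglyMeasurable.inner hm)
      (Eventually.of_forall fun r => ?_) (hu.continuous.integrable_of_hasCompactSupport huc).norm ?_
    · filter_upwards [hn] with x hx
      refine (norm_inner_le_norm _ _).trans ?_
      rw [hx, mul_one, hv, norm_smul, Real.norm_of_nonneg (hψ01 r x).1]
      exact mul_le_of_le_one_left (norm_nonneg _) (hψ01 r x).2
    · filter_upwards [measure_eq_zero_iff_ae_notMem.1 hp] with x hx
      have hxp : 0 < dist x p := dist_pos.2 hx
      refine tendsto_const_nhds.congr' ?_
      filter_upwards [Ioo_mem_nhdsGT (half_pos hxp)] with r hr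
      have : v r x = 0 := image_eq_zero_of_notMem_tsupport
        (hvzero r hr.1 x fun h => by
          have := Metric.mem_closedBall.1 h
          linarith [hr.2])
      rw [this, inner_zero_left]
  have hlim := hlim1.add hlim2
  rw [add_zero] at hlim
  have hconst : Tendsto (fun _ : ℝ => (∫ x in Ω, divergence u x) +
      ∫ x, ⟪u x, necasNormal Ω x⟫ ∂(boundaryMeasure Ω)) (𝓝[>] 0) (𝓝 0) :=
    hlim.congr' (by filter_upwards [self_mem_nhdsWithin] with r hr using (hkey r hr).symm)
  exact eq_neg_of_add_eq_zero_left (tendsto_nhds_unique tendsto_const_nhds hconst)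

theorem memLp_necasNormal
    (hm : AEStronglyMeasurable (necasNormal Ω) (boundaryMeasure Ω))
    (hn : ∀ᵐ x ∂(boundaryMeasure Ω), ‖necasNormal Ω x‖ = 1) :
    MemLp (necasNormal Ω) ⊤ (boundaryMeasure Ω) :=
  memLp_top_of_bound hm 1 (hn.mono fun _ h => h.le)

/-- **Stokes' formula** with the chart normal, on sets which are Lipschitz at all but finitely
many boundary points (at all of them in dimension one). -/
theorem stokesFormula_necasNormal (hΩ : IsOpen Ω) (S : Finset (Euc (d + 1)))
    (hdS : 1 ≤ d ∨ S = ∅) (hL : ∀ x ∈ frontier Ω, x ∉ S → IsLipschitzAt Ω x)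
    (hfin : (μHE[d] : Measure (Euc (d + 1))) (frontier Ω) < ⊤) :
    (∀ᵐ x ∂(boundaryMeasure Ω), ∃ v, IsNecasNormal Ω x v) ∧ StokesFormula Ω (necasNormal Ω) := by
  have : IsFiniteMeasure (boundaryMeasure Ω) := ⟨by simpa [boundaryMeasure] using hfin⟩
  have hpt : 1 ≤ d → ∀ p : Euc (d + 1), boundaryMeasure Ω {p} = 0 := by
    intro hd p
    have h0 : (0 : ℝ) < d := by exact_mod_cast hd
    have := Measure.nullSingletonClass_hausdorff (Euc (d + 1)) h0
    refine le_antisymm ((Measure.restrict_apply_le _ _).trans ?_) (zero_le)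
    simp [Measure.euclideanHausdorffMeasure_def]
  have hS : boundaryMeasure Ω (S : Set (Euc (d + 1))) = 0 := by
    rcases hdS with hd | rfl
    · rw [← biUnion_of_singleton (S : Set (Euc (d + 1))), measure_biUnion_null_iff S.countable_toSet]
      exact fun p _ => hpt hd p
    · simp
  have hex := ae_exists_isNecasNormal hS hL
  have hm := aestronglyMeasurable_necasNormal hS hL
  have hn := ae_norm_necasNormal hex
  have hcompl : StokesOn Ω (S : Set (Euc (d + 1)))ᶜ := by
    refine stokesOn_of_locally hm hn fun x hx => ?_
    by_cases hxf : x ∈ frontier Ω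
    · obtain ⟨c, hc, hxc⟩ := hL x hxf hx
      exact ⟨c.U, c.isOpen_U, hxc, stokesOn_chart hΩ hc⟩
    · exact ⟨(frontier Ω)ᶜ, isClosed_frontier.isOpen_compl, hxf, stokesOn_compl_frontier hΩ⟩
  have huniv : StokesOn Ω univ := by
    rcases hdS with hd | rfl
    · refine stokesOn_of_locally hm hn fun x _ => ?_
      refine ⟨((S : Set (Euc (d + 1))) \ {x})ᶜ,
        (S.finite_toSet.subset sdiff_subset).isClosed.isOpen_compl, by simp, ?_⟩
      refine stokesOn_of_punctured hd hΩ hm hn (hpt hd x) ?_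
      intro u hu huc hsupp
      refine hcompl u hu huc (hsupp.trans ?_)
      rintro y ⟨hy, hyx⟩ hyS
      exact hy ⟨hyS, hyx⟩
    · simpa using hcompl
  exact ⟨hex, memLp_necasNormal hm hn, fun u hu huc => huniv u hu huc (subset_univ _)⟩

end Global

/-! ### Vector measures with values in `ℝⁿ` -/

section VectorMeasures

variable {X : Type*} [MeasurableSpace X] {n : ℕ}

/-- The `i`-th component of an `ℝⁿ`-valued measure. -/
noncomputable def vectorMeasureComponent (D : VectorMeasure X (Euc n)) (i : Fin n) :
    SignedMeasure X :=
  D.mapRange (EuclideanSpace.proj i : Euc n →L[ℝ] ℝ).toLinearMap.toAddMonoidHom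
    (EuclideanSpace.proj i : Euc n →L[ℝ] ℝ).continuous

theorem vectorMeasureComponent_apply (D : VectorMeasure X (Euc n)) (i : Fin n) (s : Set X) :
    vectorMeasureComponent D i s = D s i := rfl

theorem sum_smul_single {n : ℕ} (v : Euc n) :
    ∑ i, v i • (EuclideanSpace.single i 1 : Euc n) = v := by
  simpa using (EuclideanSpace.basisFun (Fin n) ℝ).sum_repr v

theorem isFiniteMeasure_variation (D : VectorMeasure X (Euc n)) : IsFiniteMeasure D.variation := by
  have hle : D.variation ≤ ∑ i, (vectorMeasureComponent D i).variation := by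
    refine VectorMeasure.variation_le_of_forall_enorm_le fun s hs => ?_
    rw [Measure.coe_finsetSum, Finset.sum_apply]
    calc ‖D s‖ₑ = ‖∑ i, D s i • (EuclideanSpace.single i 1 : Euc n)‖ₑ := by
          rw [sum_smul_single]
      _ ≤ ∑ i, ‖D s i • (EuclideanSpace.single i 1 : Euc n)‖ₑ := enorm_sum_le _ _
      _ ≤ ∑ i, (vectorMeasureComponent D i).variation s := by
          refine Finset.sum_le_sum fun i _ => ?_
          rw [enorm_smul, ← vectorMeasureComponent_apply]
          have : ‖(EuclideanSpace.single i 1 : Euc n)‖ₑ = 1 := by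
            rw [← ofReal_norm]; simp
          rw [this, mul_one]
          exact VectorMeasure.enorm_measure_le_variation _ _
  have hfin : ∀ i, IsFiniteMeasure (vectorMeasureComponent D i).variation := fun i => by
    rw [← SignedMeasure.totalVariation_eq_variation, SignedMeasure.totalVariation]
    infer_instance
  refine ⟨(hle univ).trans_lt ?_⟩
  rw [Measure.coe_finsetSum, Finset.sum_apply]
  exact ENNReal.sum_lt_top.2 fun i _ => measure_lt_top _ _

/-- Polar decomposition: an `ℝⁿ`-valued measure has a density with respect to its variation. -/
theorem exists_withDensityᵥ_variation_eq (D : VectorMeasure X (Euc n)) :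
    ∃ h : X → Euc n, Integrable h D.variation ∧ D.variation.withDensityᵥ h = D := by
  have := isFiniteMeasure_variation D
  set g : Fin n → X → ℝ := fun i => (vectorMeasureComponent D i).rnDeriv D.variation with hg
  have hgi : ∀ i, Integrable (g i) D.variation := fun i => SignedMeasure.integrable_rnDeriv _ _
  have hgD : ∀ i, D.variation.withDensityᵥ (g i) = vectorMeasureComponent D i := fun i => by
    refine SignedMeasure.withDensityᵥ_rnDeriv_eq _ _
      (VectorMeasure.AbsolutelyContinuous.mk fun s hs h0 => ?_)
    rw [Measure.toENNRealVectorMeasure_apply_measurable hs] at h0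
    have : ‖D s‖ₑ = 0 :=
      le_antisymm ((VectorMeasure.enorm_measure_le_variation D s).trans_eq h0) (zero_le)
    rw [vectorMeasureComponent_apply, enorm_eq_zero.1 this]
    rfl
  have hterm : ∀ i, Integrable (fun x => g i x • (EuclideanSpace.single i 1 : Euc n))
      D.variation := fun i => (hgi i).smul_const _
  have hint : Integrable (fun x => ∑ i, g i x • (EuclideanSpace.single i 1 : Euc n))
      D.variation := integrable_finsetSum _ fun i _ => hterm i
  refine ⟨_, hint, ?_⟩
  ext1 s hs
  rw [withDensityᵥ_apply hint hs, integral_finsetSum _ fun i _ => (hterm i).integrableOn]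
  rw [← sum_smul_single (D s)]
  refine Finset.sum_congr rfl fun i _ => ?_
  rw [integral_smul_const, ← withDensityᵥ_apply (hgi i) hs, hgD, vectorMeasureComponent_apply]

/-- The vector integral against a measure with density is the integral of the inner product. -/
theorem integral_withDensityᵥ_inner {m : Measure X} [IsFiniteMeasure m] {h : X → Euc n}
    (hh : Integrable h m) {u : X → Euc n} (hu : StronglyMeasurable u) {C : ℝ}
    (hC : ∀ x, ‖u x‖ ≤ C) :
    ∫ᵛ x, u x ∂[innerSL ℝ; m.withDensityᵥ h] = ∫ x, ⟪u x, h x⟫ ∂m := by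
  set D := m.withDensityᵥ h with hD
  have hfin : IsFiniteMeasure D.variation := isFiniteMeasure_variation D
  have hsint : ∀ f : SimpleFunc X (Euc n), Integrable (fun x => ⟪f x, h x⟫) m := fun f => by
    obtain ⟨A, hA⟩ := f.exists_forall_norm_le
    refine (hh.norm.const_mul A).mono'
      (f.stronglyMeasurable.aestronglyMeasurable.inner hh.aestronglyMeasurable)
      (Eventually.of_forall fun x => ?_)
    refine (norm_inner_le_norm _ _).trans ?_
    gcongr
    exact hA x
  have hsimple : ∀ f : SimpleFunc X (Euc n),
      ∫ᵛ x, f x ∂[innerSL ℝ; D] = ∫ x, ⟪f x, h x⟫ ∂m := by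
    intro f
    induction f using SimpleFunc.induction with
    | const c hs =>
      rename_i s
      simp only [SimpleFunc.coe_piecewise, SimpleFunc.coe_const, SimpleFunc.const_zero,
        SimpleFunc.coe_zero, piecewise_eq_indicator]
      have h1 : ∫ᵛ x, s.indicator (Function.const X c) x ∂[innerSL ℝ; D] =
          ∫ᵛ x in s, c ∂[innerSL ℝ; D] := VectorMeasure.integral_indicator hs
      rw [h1, VectorMeasure.integral_const, VectorMeasure.restrict_apply _ hs MeasurableSet.univ,
        univ_inter, hD, withDensityᵥ_apply hh hs]
      have h2 : ∀ x, ⟪s.indicator (Function.const X c) x, h x⟫ =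
          s.indicator (fun x => ⟪c, h x⟫) x := fun x => by
        by_cases hx : x ∈ s <;> simp [hx]
      simp_rw [h2]
      rw [integral_indicator hs, innerSL_apply_apply, integral_inner hh.integrableOn]
    | add hdisj hf hg =>
      rename_i f g
      simp only [SimpleFunc.coe_add, Pi.add_apply, inner_add_left]
      rw [integral_add (hsint f) (hsint g), ← hf, ← hg]
      exact VectorMeasure.integral_fun_add (SimpleFunc.integrable_of_isFiniteMeasure f)
        (SimpleFunc.integrable_of_isFiniteMeasure g)
  have hlim : ∀ x, Tendsto (fun k => hu.approxBounded C k x) atTop (𝓝 (u x)) := fun x =>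
    hu.tendsto_approxBounded_of_norm_le (hC x)
  rcases isEmpty_or_nonempty X with hX | ⟨⟨x₀⟩⟩
  · have : m = 0 := Measure.eq_zero_of_isEmpty m
    subst this
    simp [VectorMeasure.integral_of_isEmpty]
  have hC0 : 0 ≤ C := (norm_nonneg _).trans (hC x₀)
  have hb : ∀ k x, ‖hu.approxBounded C k x‖ ≤ C := fun k x => hu.norm_approxBounded_le hC0 k x
  have l1 : Tendsto (fun k => ∫ᵛ x, hu.approxBounded C k x ∂[innerSL ℝ; D]) atTop
      (𝓝 (∫ᵛ x, u x ∂[innerSL ℝ; D])) := by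
    refine VectorMeasure.tendsto_integral_of_dominated_convergence (fun _ => C)
      (fun k => (hu.approxBounded C k).stronglyMeasurable.aestronglyMeasurable)
      (integrable_const C) (fun k => Eventually.of_forall (hb k)) (Eventually.of_forall hlim)
  have l2 : Tendsto (fun k => ∫ x, ⟪hu.approxBounded C k x, h x⟫ ∂m) atTop
      (𝓝 (∫ x, ⟪u x, h x⟫ ∂m)) := by
    refine tendsto_integral_of_dominated_convergence (fun x => C * ‖h x‖)
      (fun k => (hsint _).aestronglyMeasurable) (hh.norm.const_mul C)
      (fun k => Eventually.of_forall fun x => ?_) (Eventually.of_forall fun x => ?_)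
    · refine (norm_inner_le_norm _ _).trans ?_
      gcongr
      exact hb k x
    · exact (hlim x).inner tendsto_const_nhds
  simp_rw [hsimple] at l1
  exact tendsto_nhds_unique l1 l2

end VectorMeasures

/-! ### Uniqueness of the distributional gradient -/

theorem integrable_variation_of_hasCompactSupport {n : ℕ} (D : VectorMeasure (Euc n) (Euc n))
    {u : Euc n → Euc n} (hu : Continuous u) (huc : HasCompactSupport u) :
    Integrable u D.variation := by
  have := isFiniteMeasure_variation D
  exact hu.integrable_of_hasCompactSupport huc

theorem ae_eq_zero_of_integral_inner_eq_zero {n : ℕ} {m : Measure (Euc n)} [IsFiniteMeasure m]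
    {g : Euc n → Euc n} (hg : Integrable g m)
    (h : ∀ u : Euc n → Euc n, ContDiff ℝ 1 u → HasCompactSupport u → ∫ x, ⟪u x, g x⟫ ∂m = 0) :
    ∀ᵐ x ∂m, g x = 0 := by
  refine ae_eq_zero_of_integral_contDiff_smul_eq_zero hg.locallyIntegrable fun f hf hfc => ?_
  refine ext_inner_left ℝ fun v => ?_
  have hfg : Integrable (fun x => f x • g x) m := by
    obtain ⟨A, hA⟩ := hf.continuous.bounded_above_of_compact_support hfc
    refine (hg.norm.const_mul A).mono'
      (hf.continuous.aestronglyMeasurable.smul hg.aestronglyMeasurable)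
      (Eventually.of_forall fun x => ?_)
    rw [norm_smul]
    gcongr
    exact hA x
  have hf1 : ContDiff ℝ 1 f := hf.of_le (by exact_mod_cast le_top)
  have hu : ContDiff ℝ 1 fun x => f x • v := hf1.smul contDiff_const
  have huc : HasCompactSupport fun x => f x • v :=
    HasCompactSupport.intro hfc fun x hx => by
      rw [image_eq_zero_of_notMem_tsupport hx, zero_smul]
  rw [inner_zero_right, ← integral_inner hfg, ← h _ hu huc]
  refine integral_congr_ae (Eventually.of_forall fun x => ?_)
  simp only [real_inner_smul_left, real_inner_smul_right]

theorem eq_zero_of_integral_eq_zero {n : ℕ} {D : VectorMeasure (Euc n) (Euc n)}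
    (h : ∀ u : Euc n → Euc n, ContDiff ℝ 1 u → HasCompactSupport u →
      ∫ᵛ x, u x ∂[innerSL ℝ; D] = 0) : D = 0 := by
  have hfin := isFiniteMeasure_variation D
  obtain ⟨g, hg, hgD⟩ := exists_withDensityᵥ_variation_eq D
  have hg0 : g =ᵐ[D.variation] 0 :=
    ae_eq_zero_of_integral_inner_eq_zero hg fun u hu huc => by
      obtain ⟨A, hA⟩ := hu.continuous.bounded_above_of_compact_support huc
      have h1 := h u hu huc
      generalize D.variation = m at *
      subst hgD
      rwa [integral_withDensityᵥ_inner hg hu.continuous.stronglyMeasurable hA] at h1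
  rw [← hgD, WithDensityᵥEq.congr_ae hg0, withDensityᵥ_zero]

theorem IsIndicatorGradient.unique {n : ℕ} {Ω : Set (Euc n)} {D D' : VectorMeasure (Euc n) (Euc n)}
    (h : IsIndicatorGradient Ω D) (h' : IsIndicatorGradient Ω D') : D = D' := by
  rw [← sub_eq_zero]
  refine eq_zero_of_integral_eq_zero fun u hu huc => ?_
  rw [VectorMeasure.integral_sub_vectorMeasure
    (integrable_variation_of_hasCompactSupport D hu.continuous huc)
    (integrable_variation_of_hasCompactSupport D' hu.continuous huc)]
  have h1 := h u hu huc
  have h2 := h' u hu huc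
  linarith

/-! ### Differentiation of measures along open balls -/

theorem tendsto_setIntegral_closedBall_left {n : ℕ} {F : Type*} [NormedAddCommGroup F]
    [NormedSpace ℝ F] {m : Measure (Euc n)} {f : Euc n → F} (hf : Integrable f m)
    (x : Euc n) (r : ℝ) :
    Tendsto (fun s => ∫ y in Metric.closedBall x s, f y ∂m) (𝓝[<] r)
      (𝓝 (∫ y in Metric.ball x r, f y ∂m)) := by
  simp_rw [← integral_indicator Metric.isClosed_closedBall.measurableSet,
    ← integral_indicator Metric.isOpen_ball.measurableSet]
  refine tendsto_integral_filter_of_dominated_convergence (fun y => ‖f y‖)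
    (Eventually.of_forall fun s =>
      hf.aestronglyMeasurable.indicator Metric.isClosed_closedBall.measurableSet)
    (Eventually.of_forall fun s => Eventually.of_forall fun y => norm_indicator_le_norm_self _ _)
    hf.norm (Eventually.of_forall fun y => ?_)
  refine tendsto_const_nhds.congr' ?_
  by_cases hy : y ∈ Metric.ball x r
  · filter_upwards [Ioo_mem_nhdsLT (Metric.mem_ball.1 hy)] with s hs
    rw [indicator_of_mem hy, indicator_of_mem (Metric.mem_closedBall.2 hs.1.le)]
  · filter_upwards [self_mem_nhdsWithin] with s hs
    rw [indicator_of_notMem hy, indicator_of_notMem fun h =>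
      hy (Metric.mem_ball.2 ((Metric.mem_closedBall.1 h).trans_lt hs))]

theorem ae_tendsto_average_ball {n : ℕ} {F : Type*} [NormedAddCommGroup F] [NormedSpace ℝ F]
    [CompleteSpace F] {m : Measure (Euc n)} [IsFiniteMeasure m] {f : Euc n → F}
    (hf : Integrable f m) :
    ∀ᵐ x ∂m, Tendsto (fun r => ⨍ y in Metric.ball x r, f y ∂m) (𝓝[>] 0) (𝓝 (f x)) := by
  filter_upwards [(Besicovitch.vitaliFamily m).ae_tendsto_average hf.locallyIntegrable,
    m.support_mem_ae] with x hx hxs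
  have hcl : Tendsto (fun r => ⨍ y in Metric.closedBall x r, f y ∂m) (𝓝[>] 0) (𝓝 (f x)) :=
    hx.comp (Besicovitch.tendsto_filterAt m x)
  refine (Metric.nhds_basis_closedBall.tendsto_right_iff).2 fun ε hε => ?_
  obtain ⟨δ, hδ, h⟩ := mem_nhdsGT_iff_exists_Ioo_subset.1
    (hcl.eventually (Metric.closedBall_mem_nhds (f x) hε))
  filter_upwards [Ioo_mem_nhdsGT hδ] with r hr
  have hpos : m.real (Metric.ball x r) ≠ 0 := by
    refine (ENNReal.toReal_pos ?_ (measure_ne_top m _)).ne'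
    exact ((Measure.mem_support_iff_forall x).1 hxs _ (Metric.ball_mem_nhds x hr.1)).ne'
  have hreal : Tendsto (fun s => m.real (Metric.closedBall x s)) (𝓝[<] r)
      (𝓝 (m.real (Metric.ball x r))) := by
    simpa using tendsto_setIntegral_closedBall_left (integrable_const (1 : ℝ)) x r (m := m)
  have hlim : Tendsto (fun s => ⨍ y in Metric.closedBall x s, f y ∂m) (𝓝[<] r)
      (𝓝 (⨍ y in Metric.ball x r, f y ∂m)) := by
    simp_rw [setAverage_eq]
    exact (hreal.inv₀ hpos).smul (tendsto_setIntegral_closedBall_left hf x r)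
  refine Metric.isClosed_closedBall.mem_of_tendsto hlim ?_
  filter_upwards [Ioo_mem_nhdsLT hr.1] with s hs
  exact h ⟨hs.1, hs.2.trans hr.2⟩

theorem ballRatio_withDensityᵥ {n : ℕ} {m : Measure (Euc n)} {ν : Euc n → Euc n}
    (hν : Integrable ν m) (hvar : (m.withDensityᵥ ν).variation = m) (x : Euc n) (r : ℝ) :
    ballRatio (m.withDensityᵥ ν) x r = ⨍ y in Metric.ball x r, ν y ∂m := by
  rw [ballRatio, hvar, withDensityᵥ_apply hν Metric.isOpen_ball.measurableSet, setAverage_eq]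

/-! ### Main result -/

section Main

variable {d : ℕ} {Ω : Set (Euc (d + 1))}

theorem lipschitzOpen_gradient [IsFiniteMeasure (boundaryMeasure Ω)]
    (hex : ∀ᵐ x ∂(boundaryMeasure Ω), ∃ v, IsNecasNormal Ω x v)
    (hst : StokesFormula Ω (necasNormal Ω)) :
    IsIndicatorGradient Ω ((boundaryMeasure Ω).withDensityᵥ (necasNormal Ω)) ∧
      ((boundaryMeasure Ω).withDensityᵥ (necasNormal Ω)).variation = boundaryMeasure Ω := by
  have hint : Integrable (necasNormal Ω) (boundaryMeasure Ω) := hst.1.integrable le_top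
  constructor
  · intro u hu huc
    obtain ⟨A, hA⟩ := hu.continuous.bounded_above_of_compact_support huc
    rw [hst.2 u hu huc, integral_withDensityᵥ_inner hint hu.continuous.stronglyMeasurable hA]
  · rw [Measure.variation_withDensityᵥ hint]
    conv_rhs => rw [← withDensity_one (μ := boundaryMeasure Ω)]
    refine withDensity_congr_ae ?_
    filter_upwards [ae_norm_necasNormal hex] with x hx
    rw [← ofReal_norm, hx, ENNReal.ofReal_one, Pi.one_apply]

theorem StokesFormula.congr {ν ν' : Euc (d + 1) → Euc (d + 1)} (h : StokesFormula Ω ν)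
    (hν : ν' =ᵐ[boundaryMeasure Ω] ν) : StokesFormula Ω ν' := by
  refine ⟨(memLp_congr_ae hν).2 h.1, fun u hu huc => ?_⟩
  rw [h.2 u hu huc]
  congr 1
  refine integral_congr_ae ?_
  filter_upwards [hν] with x hx
  rw [hx]

end Main

theorem mainTheorem8 :
    -- Lipschitz open sets: the two normals agree
    (∀ (d : ℕ) (Ω : Set (Euc (d + 1))), IsLipschitzOpen Ω →
      (μHE[d] : Measure (Euc (d + 1))) (frontier Ω) < ⊤ →
        (∃! D : VectorMeasure (Euc (d + 1)) (Euc (d + 1)), IsIndicatorGradient Ω D) ∧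
        (∀ᵐ x ∂(boundaryMeasure Ω), ∃! v : Euc (d + 1), IsNecasNormal Ω x v) ∧
        ∀ D : VectorMeasure (Euc (d + 1)) (Euc (d + 1)), IsIndicatorGradient Ω D →
          D.variation = boundaryMeasure Ω ∧
          reducedBoundary D ⊆ frontier Ω ∧
          (μHE[d] : Measure (Euc (d + 1))) (frontier Ω \ reducedBoundary D) = 0 ∧
          deGiorgiNormal D =ᵐ[boundaryMeasure Ω] necasNormal Ω ∧
          (∀ c : LipschitzChart d, c.IsChartOf Ω →
            ∀ᵐ x ∂(boundaryMeasure Ω), x ∈ c.U →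
              DifferentiableAt ℝ c.φ (c.R x).fst ∧ deGiorgiNormal D x = c.normal x) ∧
          (∀ᵐ x ∂(boundaryMeasure Ω),
            Tendsto (fun r : ℝ =>
              volume.real ((Ω ∆ {y | 0 < ⟪y - x, deGiorgiNormal D x⟫}) ∩ Metric.ball x r)
                / r ^ (d + 1)) (𝓝[>] 0) (𝓝 0)) ∧
          StokesFormula Ω (deGiorgiNormal D) ∧
          StokesFormula Ω (necasNormal Ω)) ∧
    -- finitely many singular boundary points, in dimension `d + 1 ≥ 2`
    (∀ (d : ℕ), 1 ≤ d → ∀ (Ω : Set (Euc (d + 1))) (S : Finset (Euc (d + 1))), IsOpen Ω →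
      (∀ x ∈ frontier Ω, x ∉ S → IsLipschitzAt Ω x) →
      (μHE[d] : Measure (Euc (d + 1))) (frontier Ω) < ⊤ →
        (∀ᵐ x ∂(boundaryMeasure Ω), ∃! v : Euc (d + 1), IsNecasNormal Ω x v) ∧
        StokesFormula Ω (necasNormal Ω)) := by
  constructor
  · intro d Ω hΩ hfin
    have hfm : IsFiniteMeasure (boundaryMeasure Ω) := ⟨by simpa [boundaryMeasure] using hfin⟩
    obtain ⟨hex, hst⟩ := stokesFormula_necasNormal hΩ.1 ∅ (Or.inr rfl)
      (fun x hx _ => hΩ.2 x hx) hfin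
    obtain ⟨hgrad, hvar⟩ := lipschitzOpen_gradient hex hst
    have hint : Integrable (necasNormal Ω) (boundaryMeasure Ω) := hst.1.integrable le_top
    refine ⟨⟨_, hgrad, fun D hD => hD.unique hgrad⟩, ?_, fun D hD => ?_⟩
    · filter_upwards [hex] with x ⟨v, hv⟩ using ⟨v, hv, fun w hw => hw.unique hv⟩
    obtain rfl := hD.unique hgrad
    have hratio : ∀ᵐ x ∂(boundaryMeasure Ω), Tendsto
        (ballRatio ((boundaryMeasure Ω).withDensityᵥ (necasNormal Ω)) x) (𝓝[>] 0)
        (𝓝 (necasNormal Ω x)) := by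
      filter_upwards [ae_tendsto_average_ball hint] with x hx
      exact hx.congr fun r => (ballRatio_withDensityᵥ hint hvar x r).symm
    have heq : deGiorgiNormal ((boundaryMeasure Ω).withDensityᵥ (necasNormal Ω))
        =ᵐ[boundaryMeasure Ω] necasNormal Ω := by
      filter_upwards [hratio] with x hx using hx.limUnder_eq
    refine ⟨hvar, ?_, ?_, heq, fun c hc => ?_, ?_, hst.congr heq, hst⟩
    · rintro x ⟨hx, -⟩
      rw [hvar] at hx
      exact Measure.support_subset_of_isClosed isClosed_frontier
        (ae_restrict_mem isClosed_frontier.measurableSet) hx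
    · have : ∀ᵐ x ∂(boundaryMeasure Ω),
          x ∈ reducedBoundary ((boundaryMeasure Ω).withDensityᵥ (necasNormal Ω)) := by
        filter_upwards [hratio, ae_norm_necasNormal hex, (boundaryMeasure Ω).support_mem_ae]
          with x hx hx1 hxs
        exact ⟨by rwa [hvar], _, hx1, hx⟩
      rw [boundaryMeasure, ae_restrict_iff' isClosed_frontier.measurableSet, ae_iff] at this
      refine measure_mono_null (fun x hx => ?_) this
      exact fun h => hx.2 (h hx.1)
    · filter_upwards [heq, LipschitzChart.ae_isNecasNormal hc] with x hx hxc hxU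
      exact ⟨(hxc hxU).1, by rw [hx, (hxc hxU).2.necasNormal_eq]⟩
    · filter_upwards [heq, hex] with x hx hxe
      rw [hx]
      have hN := isNecasNormal_necasNormal hxe
      exact hN.isRayNormal.tendsto_blowup hΩ.1.measurableSet hN.norm_eq_one
  · intro d hd Ω S hΩ hL hfin
    obtain ⟨hex, hst⟩ := stokesFormula_necasNormal hΩ S (Or.inl hd) hL hfin
    refine ⟨?_, hst⟩
    filter_upwards [hex] with x ⟨v, hv⟩ using ⟨v, hv, fun w hw => hw.unique hv⟩
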